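/- Let $K$ be a field, let $m,n\ge 0$, and let $S=K[x_1,\dots,x_m,y_1,\dots,y_n]$ be the polynomial ring with its standard bigrading, $\deg x_i=(1,0)$ and $\deg y_j=(0,1)$. Put $Q=(y_1,\dots,y_n)$. For an $S$-module $N$ let $H^i_Q(N)$ denote the $i$-th local cohomology module of $N$ with support in $Q$, and let $\mathrm{cd}(Q,N)$ be the largest $i$ with $H^i_Q(N)\neq 0$ (with $\mathrm{cd}(Q,N)=-\infty$ if there is no such $i$). Call $N$ Cohen–Macaulay with respect to $Q$ if there is an integer $q$ with $H^i_Q(N)=0$ for all $i\ne q$. A finitely generated ($\mathbb{Z}^2$-)bigraded $S$-module $M$ is sequentially Cohen–Macaulay with respect to $Q$ if it has a Cohen–Macaulay filtration with respect to $Q$, that is, a finite chain $0=M_0\subsetneq M_1\subsetneq\dots\subsetneq M_r=M$ of bigraded submodules such that every $M_i/M_{i-1}$ is Cohen–Macaulay with respect to $Q$ and $0\le \mathrm{cd}(Q,M_1/M_0)<\mathrm{cd}(Q,M_2/M_1)<\dots<\mathrm{cd}(Q,M_r/M_{r-1})$. An $S$-module $N$ is called $Q$-cofinite if $\mathrm{Supp}(N)\subseteq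 V(Q)$ and $\mathrm{Ext}^i_S(S/Q,N)$ is finitely generated for all $i\ge 0$. **Proposition.** Let $M$ be a finitely generated bigraded $S$-module that is sequentially Cohen–Macaulay with respect to $Q$. For every Cohen–Macaulay filtration $0=M_0\subsetneq M_1\subsetneq\dots\subsetneq M_r=M$ with respect to $Q$, put $q_i=\mathrm{cd}(Q,M_i)$ for $i=1,\dots,r$. If $q_1>0$, then $H^k_Q(M)$ is not a finitely generated $S$-module for any $k\in\{q_1,\dots,q_r\}$. Moreover, whether or not $q_1>0$, $H^k_Q(M)$ is $Q$-cofinite for all $k\ge 0$. -/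

import Mathlib

open CategoryTheory

universe u

namespace BigradedCM

section General

variable {R : Type u} [CommRing R]

/-- The local cohomology module `H^i_I(M)`. -/
noncomputable abbrev H (I : Ideal R) (i : ℕ) (M : Type u) [AddCommGroup M] [Module R M] :
    ModuleCat.{u} R :=
  (localCohomology I i).obj (ModuleCat.of R M)

/-- The cohomological dimension `cd(I, M)`: the supremum of all `i` with `H^i_I(M) ≠ 0`.
It is `⊥` when every local cohomology module vanishes, for instance for `M = 0`. -/
noncomputable def cd (I : Ideal R) (M : Type u) [AddCommGroup M] [Module R M] : WithBot ℕ∞ :=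
  sSup {d : WithBot ℕ∞ | ∃ i : ℕ, Nontrivial (H I i M) ∧ d = ((i : ℕ∞) : WithBot ℕ∞)}

/-- `M` is (relative) Cohen-Macaulay with respect to `I`: for some `q : ℤ`, the modules
`H^i_I(M)` vanish for all `i ≠ q`. -/
def IsRelCohenMacaulay (I : Ideal R) (M : Type u) [AddCommGroup M] [Module R M] : Prop :=
  ∃ q : ℤ, ∀ i : ℕ, (i : ℤ) ≠ q → Subsingleton (H I i M)

/-- `N` is `I`-cofinite: `Supp N ⊆ V(I)` and all `Ext^i_R(R/I, N)` are finitely generated. -/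
def IsCofinite (I : Ideal R) (N : ModuleCat.{u} R) : Prop :=
  Module.support R N ⊆ PrimeSpectrum.zeroLocus (I : Set R) ∧
    ∀ i : ℕ, Module.Finite R (Abelian.Ext (ModuleCat.of R (R ⧸ I)) N i)

/-- The `i`-th successive quotient `F_{i+1} / F_i` of a family of submodules of `M`. -/
abbrev FiltQuot {M : Type u} [AddCommGroup M] [Module R M] {r : ℕ}
    (F : Fin (r + 1) → Submodule R M) (i : Fin r) : Type u :=
  F i.succ ⧸ (F i.castSucc).submoduleOf (F i.succ)

end General

section Bigraded

/-- The polynomial ring `S = K[x_1, …, x_m, y_1, …, y_n]`; the `x`-variables are indexed by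
`Sum.inl`, the `y`-variables by `Sum.inr`. -/
abbrev PolyRing (K : Type u) [Field K] (m n : ℕ) : Type u := MvPolynomial (Fin m ⊕ Fin n) K

variable (K : Type u) [Field K] (m n : ℕ)

/-- The bidegrees of the variables: `deg x_i = (1, 0)` and `deg y_j = (0, 1)`. -/
def bidegree : Fin m ⊕ Fin n → ℤ × ℤ := Sum.elim (fun _ => (1, 0)) (fun _ => (0, 1))

/-- The standard bigrading of `S`, indexed by `ℤ × ℤ` (the components outside of `ℕ × ℕ`
vanish). -/
noncomputable abbrev bigrading : ℤ × ℤ → Submodule K (PolyRing K m n) :=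
  MvPolynomial.weightedHomogeneousSubmodule K (bidegree m n)

/-- The bigraded irrelevant ideal `Q = (y_1, …, y_n)`. -/
noncomputable def idealQ : Ideal (PolyRing K m n) :=
  Ideal.span (Set.range fun j : Fin n => MvPolynomial.X (Sum.inr j))

variable {K m n} {M : Type u} [AddCommGroup M] [Module (PolyRing K m n) M]

/-- `F` is a Cohen-Macaulay filtration `0 = F_0 ⊊ F_1 ⊊ ⋯ ⊊ F_r = M` of the bigraded module
`M = ⨁ ℳ (a, b)` with respect to `Q`. -/
structure IsCMFiltration (ℳ : ℤ × ℤ → AddSubgroup M) [DirectSum.Decomposition ℳ] {r : ℕ}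
    (F : Fin (r + 1) → Submodule (PolyRing K m n) M) : Prop where
  bot : F 0 = ⊥
  top : F (Fin.last r) = ⊤
  strictMono : StrictMono F
  homogeneous : ∀ i, (F i).IsHomogeneous ℳ
  cohenMacaulay : ∀ i : Fin r, IsRelCohenMacaulay (idealQ K m n) (FiltQuot F i)
  cd_nonneg : ∀ i : Fin r, 0 ≤ cd (idealQ K m n) (FiltQuot F i)
  cd_strictMono : StrictMono fun i : Fin r => cd (idealQ K m n) (FiltQuot F i)

variable (K m n) in
/-- The bigraded module `M = ⨁ ℳ (a, b)` is sequentially Cohen-Macaulay with respect to `Q`. -/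
def IsSequentiallyCM (ℳ : ℤ × ℤ → AddSubgroup M) [DirectSum.Decomposition ℳ] : Prop :=
  ∃ (r : ℕ) (F : Fin (r + 1) → Submodule (PolyRing K m n) M), IsCMFiltration ℳ F

end Bigraded

end BigradedCM

/-! Each quotient of the filtration has local cohomology in exactly one degree `c i`, and these
degrees increase strictly. The long exact sequences therefore give `cd (F i.succ) = c i`, identify
`H^(c j)(M)` with `H^(c j)` of the `j`-th quotient, and make every other `H^k(M)` vanish
(`extLimit_filtration`, `cd_filtration`, `H_filtration`). Both claims reduce to a module `N` whose
cohomology is concentrated in one degree `c`.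

For such `N` the key is `Ext^i(R/I, H^c(N)) ≃ Ext^(i+c)(R/I, N)` (`nonempty_ext_extLimit_equiv`).
This is a collapsed Grothendieck spectral sequence, obtained here by dimension shifting along
torsion-free injective modules. If `N` is finitely generated, so is the right-hand side, which gives
cofiniteness.

For non-finiteness let `I` be generated by `d` variables. Then `Ext^d(S/I, H)` surjects onto `H/IH`,
while `Ext^j(S/I, -)` vanishes for `j > d`. With `c > 0` the key isomorphism in degree `i = d`
forces `H = IH` for `H = H^c(N)`. A finitely generated `H` would be killed by some `I^t`, so `H =
I^t H = 0`, a contradiction.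

`localCohomology` is built from the derived functors `_root_.Ext`, while cofiniteness and the long
exact sequences use `Abelian.Ext`; the two are matched through cocycles of a projective resolution.
-/

namespace BigradedCM

open Limits Abelian

/-! ### Comparison of the two constructions of `Ext`. -/

section CompareExt

variable {R : Type u} [CommRing R] {X X' Y : ModuleCat.{u} R}

/-- The cocycles of degree `n` of `Hom(P, Y)` for a projective resolution `P`. -/
def cocycles (P : ProjectiveResolution X) (Y : ModuleCat.{u} R) (n : ℕ) :
    Submodule R (P.complex.X n ⟶ Y) where
  carrier := {f | P.complex.d (n + 1) n ≫ f = 0}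
  add_mem' hf hg := by
    simp only [Set.mem_ofPred_eq] at hf hg ⊢
    rw [Preadditive.comp_add, hf, hg, add_zero]
  zero_mem' := by simp
  smul_mem' r f hf := by
    simp only [Set.mem_ofPred_eq] at hf ⊢
    rw [Linear.comp_smul, hf, smul_zero]

lemma mem_cocycles {P : ProjectiveResolution X} {n : ℕ} {f : P.complex.X n ⟶ Y} :
    f ∈ cocycles P Y n ↔ P.complex.d (n + 1) n ≫ f = 0 := Iff.rfl

/-- Cocycles represent classes in `Abelian.Ext`. -/
noncomputable def cocyclesToExt (P : ProjectiveResolution X) (Y : ModuleCat.{u} R) (n : ℕ) :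
    cocycles P Y n →ₗ[R] Abelian.Ext X Y n where
  toFun f := P.extMk f.1 (n + 1) rfl (mem_cocycles.1 f.2)
  map_add' f g := (P.add_extMk f.1 g.1 (n + 1) rfl f.2 g.2).symm
  map_smul' r f := by
    rw [RingHom.id_apply, Ext.smul_eq_comp_mk₀, P.extMk_comp_mk₀]
    congr 1

lemma cocyclesToExt_surjective (P : ProjectiveResolution X) (Y : ModuleCat.{u} R) (n : ℕ) :
    Function.Surjective (cocyclesToExt P Y n) := fun x ↦ by
  obtain ⟨f, hf, h⟩ := P.extMk_surjective x (n + 1) rfl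
  exact ⟨⟨f, hf⟩, h⟩

/-- As a `ℤ`-indexed cochain complex the resolution lives in degrees `≤ 0`, so a coboundary in
degree zero factors through a zero object. -/
lemma extMk_zero_eq_zero_iff (P : ProjectiveResolution X) (f : P.complex.X 0 ⟶ Y)
    (hf : P.complex.d 1 0 ≫ f = 0) : P.extMk f 1 rfl hf = 0 ↔ f = 0 := by
  refine ⟨fun h ↦ ?_, fun h ↦ by subst h; exact P.extMk_zero 1 rfl⟩
  rw [← P.extEquivCohomologyClass.apply_eq_iff_eq, P.extEquivCohomologyClass_extMk,
    P.extEquivCohomologyClass_zero, CochainComplex.HomComplex.CohomologyClass.mk_eq_zero_iff,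
    CochainComplex.HomComplex.Cocycle.toSingleMk_mem_coboundaries_iff _ _ _ _ _ 1 (by simp)] at h
  obtain ⟨g, hg⟩ := h
  have h1 : IsZero (P.cochainComplex.X 1) := P.cochainComplex.isZero_of_isStrictlyLE 0 1 (by simp)
  rw [h1.eq_of_src g 0, comp_zero, eq_comm] at hg
  rw [← cancel_epi (P.cochainComplexXIso (-(0 : ℕ)) 0 rfl).hom, comp_zero]
  exact hg

/-- The free index `j` lets degree zero and positive degrees share one description of coboundaries:
the differential vanishes for every `j ≠ p`. -/
lemma exists_d_comp_eq_iff (P : ProjectiveResolution X) {p : ℕ} (f : P.complex.X (p + 1) ⟶ Y) :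
    (∃ (j : ℕ) (g : P.complex.X j ⟶ Y), P.complex.d (p + 1) j ≫ g = f) ↔
      ∃ g : P.complex.X p ⟶ Y, P.complex.d (p + 1) p ≫ g = f := by
  refine ⟨fun ⟨j, g, hg⟩ ↦ ?_, fun ⟨g, hg⟩ ↦ ⟨p, g, hg⟩⟩
  by_cases hj : j + 1 = p + 1
  · obtain rfl : j = p := by omega
    exact ⟨g, hg⟩
  · rw [P.complex.shape _ _ hj, zero_comp] at hg
    exact ⟨0, by rw [comp_zero, hg]⟩

lemma exists_d_zero_comp_eq_iff (P : ProjectiveResolution X) (f : P.complex.X 0 ⟶ Y) :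
    (∃ (j : ℕ) (g : P.complex.X j ⟶ Y), P.complex.d 0 j ≫ g = f) ↔ f = 0 := by
  refine ⟨fun ⟨j, g, hg⟩ ↦ ?_, fun h ↦ ⟨0, 0, by simp [h]⟩⟩
  rw [← hg, P.complex.shape _ _ (by simp), zero_comp]

lemma cocyclesToExt_eq_zero_iff (P : ProjectiveResolution X) {n : ℕ} (f : cocycles P Y n) :
    cocyclesToExt P Y n f = 0 ↔
      ∃ (j : ℕ) (g : P.complex.X j ⟶ Y), P.complex.d n j ≫ g = f.1 := by
  rcases n with - | p
  · exact (extMk_zero_eq_zero_iff P f.1 f.2).trans (exists_d_zero_comp_eq_iff P f.1).symm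
  · exact (P.extMk_eq_zero_iff f.1 (p + 2) rfl f.2 p rfl).trans (exists_d_comp_eq_iff P f.1).symm

/-- The inclusion of cocycles into the cycles of the complex `Hom(P, Y)`. -/
noncomputable def cocyclesToCycles (P : ProjectiveResolution X) (Y : ModuleCat.{u} R) (n : ℕ) :
    ModuleCat.of R (cocycles P Y n) ⟶ (P.complex.linearYonedaObj R Y).cycles n :=
  (P.complex.linearYonedaObj R Y).liftCycles (ModuleCat.ofHom (cocycles P Y n).subtype) (n + 1)
    (by simp) (by
      ext f
      exact f.2)

/-- Cocycles represent classes in the left derived functors of `Hom(-, Y)`. -/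
noncomputable def cocyclesToDerived (P : ProjectiveResolution X) (Y : ModuleCat.{u} R) (n : ℕ) :
    ModuleCat.of R (cocycles P Y n) ⟶ ((_root_.Ext R (ModuleCat.{u} R) n).obj (.op X)).obj Y :=
  cocyclesToCycles P Y n ≫ (P.complex.linearYonedaObj R Y).homologyπ n ≫ (P.isoExt n Y).inv

lemma iCycles_cocyclesToCycles (P : ProjectiveResolution X) {n : ℕ} (f : cocycles P Y n) :
    (P.complex.linearYonedaObj R Y).iCycles n (cocyclesToCycles P Y n f) = f.1 := by
  have := (P.complex.linearYonedaObj R Y).liftCycles_i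
    (ModuleCat.ofHom (cocycles P Y n).subtype) (n + 1) (by simp) (by
      ext f
      exact f.2)
  exact ConcreteCategory.congr_hom this f

lemma iCycles_injective (K : CochainComplex (ModuleCat.{u} R) ℕ) (n : ℕ) :
    Function.Injective (K.iCycles n) :=
  (ModuleCat.mono_iff_injective _).1 inferInstance

lemma cocyclesToDerived_surjective (P : ProjectiveResolution X) (Y : ModuleCat.{u} R) (n : ℕ) :
    Function.Surjective (cocyclesToDerived P Y n) := by
  have h1 : Function.Surjective (cocyclesToCycles P Y n) := fun z ↦ by
    refine ⟨⟨(P.complex.linearYonedaObj R Y).iCycles n z, ?_⟩, iCycles_injective _ _ ?_⟩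
    · have := ConcreteCategory.congr_hom ((P.complex.linearYonedaObj R Y).iCycles_d n (n + 1)) z
      exact this
    · exact iCycles_cocyclesToCycles P _
  have h2 : Function.Surjective ((P.complex.linearYonedaObj R Y).homologyπ n ≫
      (P.isoExt n Y).inv) := (ModuleCat.epi_iff_surjective _).1 (epi_comp _ _)
  exact h2.comp h1

lemma cocyclesToDerived_eq_zero_iff (P : ProjectiveResolution X) {n : ℕ} (f : cocycles P Y n) :
    cocyclesToDerived P Y n f = 0 ↔
      ∃ (j : ℕ) (g : P.complex.X j ⟶ Y), P.complex.d n j ≫ g = f.1 := by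
  let K : CochainComplex (ModuleCat.{u} R) ℕ := P.complex.linearYonedaObj R Y
  have hinj : Function.Injective (P.isoExt (R := R) n Y).inv :=
    (ModuleCat.mono_iff_injective _).1 inferInstance
  have h1 : cocyclesToDerived P Y n f = 0 ↔ K.homologyπ n (cocyclesToCycles P Y n f) = 0 :=
    ⟨fun h ↦ hinj (h.trans (map_zero _).symm), fun h ↦ by
      change (P.isoExt n Y).inv (K.homologyπ n (cocyclesToCycles P Y n f)) = 0
      rw [h, map_zero]⟩
  have h2 : ∀ j, K.homologyπ n (cocyclesToCycles P Y n f) = 0 →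
    (ComplexShape.up ℕ).prev n = j → ∃ g, K.toCycles j n g = cocyclesToCycles P Y n f := by
    rintro j h hj
    have := ShortComplex.exact_of_g_is_cokernel
      (ShortComplex.mk _ _ (K.toCycles_comp_homologyπ j n)) (K.homologyIsCokernel j n hj)
    rw [ShortComplex.moduleCat_exact_iff] at this
    exact this _ h
  rw [h1]
  constructor
  · intro h
    obtain ⟨g, hg⟩ := h2 _ h rfl
    refine ⟨_, g, ?_⟩
    have := congrArg (K.iCycles n) hg
    rw [← ConcreteCategory.comp_apply, HomologicalComplex.toCycles_i,
      iCycles_cocyclesToCycles] at this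
    exact this
  · rintro ⟨j, g, hg⟩
    have : K.toCycles j n g = cocyclesToCycles P Y n f := by
      apply iCycles_injective
      exact ((ConcreteCategory.congr_hom (K.toCycles_i j n) g).trans hg).trans
        (iCycles_cocyclesToCycles P f).symm
    rw [← this]
    exact ConcreteCategory.congr_hom (K.toCycles_comp_homologyπ j n) g

/-- Composition of cocycles with a morphism of projective resolutions. -/
def cocyclesMap {P : ProjectiveResolution X} {P' : ProjectiveResolution X'} {g : X' ⟶ X}
    (φ : ProjectiveResolution.Hom P' P g) (n : ℕ) (f : cocycles P Y n) : cocycles P' Y n :=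
  ⟨φ.hom.f n ≫ f.1, mem_cocycles.2 (by
    rw [← φ.hom.comm_assoc, mem_cocycles.1 f.2, comp_zero])⟩

/-- The morphism `Hom(P, Y) ⟶ Hom(P', Y)` induced by `φ : P' ⟶ P`. -/
noncomputable def homComplexMap {P : ProjectiveResolution X} {P' : ProjectiveResolution X'}
    {g : X' ⟶ X} (φ : ProjectiveResolution.Hom P' P g) (Y : ModuleCat.{u} R) :
    P.complex.linearYonedaObj R Y ⟶ P'.complex.linearYonedaObj R Y :=
  (HomologicalComplex.unopFunctor _ _).map
    (((((linearYoneda R (ModuleCat.{u} R)).obj Y).rightOp.mapHomologicalComplex _).map φ.hom).op)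

lemma comp_eq_of_squares {C : Type*} [Category* C] {A B D A' B' D' : C} {a : A ⟶ B} {b : B ⟶ D}
    {c : D ⟶ D'} {m : B ⟶ B'} {b' : B' ⟶ D'} {d : A ⟶ A'} {a' : A' ⟶ B'}
    (h : b ≫ c = m ≫ b') (h' : d ≫ a' = a ≫ m) : (a ≫ b) ≫ c = d ≫ a' ≫ b' := by
  rw [Category.assoc, h, reassoc_of% h']

/-- `isoExt` combines the computation of a left derived functor in the opposite category with the
compatibility of homology and `unop`. Its naturality is the pasting of the two naturality squares.
-/
lemma isoExt_inv_naturality {P : ProjectiveResolution X} {P' : ProjectiveResolution X'}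
    {g : X' ⟶ X} (φ : ProjectiveResolution.Hom P' P g) (n : ℕ) :
    (P.isoExt n Y).inv ≫ ((_root_.Ext R (ModuleCat.{u} R) n).map g.op).app Y =
      HomologicalComplex.homologyMap (homComplexMap φ Y) n ≫ (P'.isoExt n Y).inv := by
  have h1 := congrArg Quiver.Hom.unop (ProjectiveResolution.isoLeftDerivedObj_hom_naturality g P' P
    φ.hom (φ.hom_f_zero_comp_π_f_zero) ((linearYoneda R (ModuleCat.{u} R)).obj Y).rightOp n)
  have h2 := congrArg Quiver.Hom.unop (HomologicalComplex.homologyOp_hom_naturality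
    (homComplexMap φ Y) n)
  have h3 : ((P.isoLeftDerivedObj ((linearYoneda R (ModuleCat.{u} R)).obj Y).rightOp n).hom).unop ≫
      ((_root_.Ext R (ModuleCat.{u} R) n).map g.op).app Y =
      (HomologicalComplex.homologyMap
        ((((linearYoneda R (ModuleCat.{u} R)).obj Y).rightOp.mapHomologicalComplex _).map
          φ.hom) n).unop ≫
      ((P'.isoLeftDerivedObj ((linearYoneda R (ModuleCat.{u} R)).obj Y).rightOp n).hom).unop :=
    h1
  have h4 : HomologicalComplex.homologyMap (homComplexMap φ Y) n ≫
      (HomologicalComplex.homologyUnop _ n).hom = (HomologicalComplex.homologyUnop _ n).hom ≫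
      (HomologicalComplex.homologyMap
        ((((linearYoneda R (ModuleCat.{u} R)).obj Y).rightOp.mapHomologicalComplex _).map
          φ.hom) n).unop :=
    h2.symm
  exact comp_eq_of_squares h3 h4

lemma cocyclesToCycles_map {P : ProjectiveResolution X} {P' : ProjectiveResolution X'}
    {g : X' ⟶ X} (φ : ProjectiveResolution.Hom P' P g) (n : ℕ) (f : cocycles P Y n) :
    HomologicalComplex.cyclesMap (homComplexMap φ Y) n (cocyclesToCycles P Y n f) =
      cocyclesToCycles P' Y n (cocyclesMap φ n f) := by
  apply iCycles_injective
  refine (ConcreteCategory.congr_hom (HomologicalComplex.cyclesMap_i (homComplexMap φ Y) n)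
    (cocyclesToCycles P Y n f)).trans ?_
  rw [iCycles_cocyclesToCycles]
  exact congrArg ((homComplexMap φ Y).f n) (iCycles_cocyclesToCycles P f)

lemma cocyclesToDerived_map {P : ProjectiveResolution X} {P' : ProjectiveResolution X'}
    {g : X' ⟶ X} (φ : ProjectiveResolution.Hom P' P g) (n : ℕ) (f : cocycles P Y n) :
    ((_root_.Ext R (ModuleCat.{u} R) n).map g.op).app Y (cocyclesToDerived P Y n f) =
      cocyclesToDerived P' Y n (cocyclesMap φ n f) := by
  have h := ConcreteCategory.congr_hom (isoExt_inv_naturality (Y := Y) φ n)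
    ((P.complex.linearYonedaObj R Y).homologyπ n (cocyclesToCycles P Y n f))
  refine h.trans ?_
  have h' := ConcreteCategory.congr_hom (HomologicalComplex.homologyπ_naturality
    (homComplexMap φ Y) n) (cocyclesToCycles P Y n f)
  refine (congrArg (P'.isoExt n Y).inv h').trans ?_
  exact congrArg (fun z ↦ (P'.isoExt n Y).inv
    ((P'.complex.linearYonedaObj R Y).homologyπ n z)) (cocyclesToCycles_map φ n f)

lemma cocyclesToExt_map {P : ProjectiveResolution X} {P' : ProjectiveResolution X'}
    {g : X' ⟶ X} (φ : ProjectiveResolution.Hom P' P g) (n : ℕ) (f : cocycles P Y n) :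
    (Ext.mk₀ g).comp (cocyclesToExt P Y n f) (zero_add n) =
      cocyclesToExt P' Y n (cocyclesMap φ n f) :=
  ProjectiveResolution.mk₀_comp_extMk f.1 (n + 1) rfl f.2 φ

/-- The derived functor of `Hom(-, Y)` is `Abelian.Ext`. -/
lemma exists_extEquiv (X Y : ModuleCat.{u} R) (n : ℕ) (P : ProjectiveResolution X) :
    ∃ e : ((_root_.Ext R (ModuleCat.{u} R) n).obj (.op X)).obj Y ≃ₗ[R] Abelian.Ext X Y n,
      ∀ f, e (cocyclesToDerived P Y n f) = cocyclesToExt P Y n f := by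
  -- Both maps are surjections from the same cocycles with the coboundaries as kernel, so both
  -- targets are the same quotient.
  have hk : LinearMap.ker (cocyclesToDerived P Y n).hom = LinearMap.ker (cocyclesToExt P Y n) := by
    ext f
    exact (cocyclesToDerived_eq_zero_iff P f).trans (cocyclesToExt_eq_zero_iff P f).symm
  refine ⟨((cocyclesToDerived P Y n).hom.quotKerEquivOfSurjective
    (cocyclesToDerived_surjective P Y n)).symm ≪≫ₗ Submodule.quotEquivOfEq _ _ hk ≪≫ₗ
      (cocyclesToExt P Y n).quotKerEquivOfSurjective (cocyclesToExt_surjective P Y n), fun f ↦ ?_⟩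
  have h1 : ((cocyclesToDerived P Y n).hom.quotKerEquivOfSurjective
      (cocyclesToDerived_surjective P Y n)).symm (cocyclesToDerived P Y n f) =
        Submodule.Quotient.mk f := by
    rw [LinearEquiv.symm_apply_eq]
    rfl
  simp only [LinearEquiv.trans_apply]
  rw [h1]
  rfl

/-- The comparison isomorphism between the derived functor of `Hom(-, Y)` and `Abelian.Ext`. -/
noncomputable def extEquiv (X Y : ModuleCat.{u} R) (n : ℕ) :
    ((_root_.Ext R (ModuleCat.{u} R) n).obj (.op X)).obj Y ≃ₗ[R] Abelian.Ext X Y n :=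
  (exists_extEquiv X Y n (projectiveResolution X)).choose

lemma extEquiv_cocyclesToDerived (X Y : ModuleCat.{u} R) (n : ℕ)
    (f : cocycles (projectiveResolution X) Y n) :
    extEquiv X Y n (cocyclesToDerived (projectiveResolution X) Y n f) =
      cocyclesToExt (projectiveResolution X) Y n f :=
  (exists_extEquiv X Y n (projectiveResolution X)).choose_spec f

lemma extEquiv_naturality {X X' : ModuleCat.{u} R} (g : X' ⟶ X) (Y : ModuleCat.{u} R) (n : ℕ)
    (x : ((_root_.Ext R (ModuleCat.{u} R) n).obj (.op X)).obj Y) :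
    extEquiv X' Y n (((_root_.Ext R (ModuleCat.{u} R) n).map g.op).app Y x) =
      (Ext.mk₀ g).comp (extEquiv X Y n x) (zero_add n) := by
  obtain ⟨f, rfl⟩ := cocyclesToDerived_surjective (projectiveResolution X) Y n x
  -- On cocycles, both functorialities are composition with a lift of `g` to the resolutions.
  let φ : ProjectiveResolution.Hom (projectiveResolution X') (projectiveResolution X) g :=
    ⟨ProjectiveResolution.lift g _ _, ProjectiveResolution.lift_commutes_zero g _ _⟩
  have h1 := congrArg (extEquiv X' Y n) (cocyclesToDerived_map φ n f)
  have h2 := extEquiv_cocyclesToDerived X' Y n (cocyclesMap φ n f)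
  have h3 := congrArg (fun z ↦ (Ext.mk₀ g).comp z (zero_add n)) (extEquiv_cocyclesToDerived X Y n f)
  exact h1.trans (h2.trans ((cocyclesToExt_map φ n f).symm.trans h3.symm))

end CompareExt

/-! ### Local cohomology as a direct limit of `Abelian.Ext` modules. -/

section DirectLimit

variable {R : Type u} [CommRing R] (I : Ideal R)

/-- The module `R ⧸ I ^ t`. -/
abbrev powQuot (t : ℕ) : ModuleCat.{u} R := ModuleCat.of R (R ⧸ I ^ t)

/-- The projection `R ⧸ I ^ t ⟶ R ⧸ I ^ s` for `s ≤ t`. -/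
def powQuotMap {s t : ℕ} (h : s ≤ t) : powQuot I t ⟶ powQuot I s :=
  ModuleCat.ofHom (Submodule.mapQ _ _ LinearMap.id (Ideal.pow_le_pow_right h))

lemma powQuotMap_refl (t : ℕ) : powQuotMap I (le_refl t) = 𝟙 _ := by
  ext
  rfl

lemma powQuotMap_comp {s t v : ℕ} (h : s ≤ t) (h' : t ≤ v) :
    powQuotMap I h' ≫ powQuotMap I h = powQuotMap I (h.trans h') := by
  ext
  rfl

/-- The transition maps `Ext^i(R ⧸ I ^ s, N) → Ext^i(R ⧸ I ^ t, N)`. -/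
noncomputable def extTransition (i : ℕ) (N : ModuleCat.{u} R) (s t : ℕ) (h : s ≤ t) :
    Abelian.Ext (powQuot I s) N i →ₗ[R] Abelian.Ext (powQuot I t) N i :=
  (Ext.mk₀ (powQuotMap I h)).precompOfLinear R N (zero_add i)

lemma extTransition_apply (i : ℕ) (N : ModuleCat.{u} R) {s t : ℕ} (h : s ≤ t)
    (x : Abelian.Ext (powQuot I s) N i) :
    extTransition I i N s t h x = (Ext.mk₀ (powQuotMap I h)).comp x (zero_add i) := rfl

instance (i : ℕ) (N : ModuleCat.{u} R) :
    DirectedSystem (fun t ↦ Abelian.Ext (powQuot I t) N i)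
      (fun s t h ↦ extTransition I i N s t h) where
  map_self t x := by simp [extTransition_apply, powQuotMap_refl]
  map_map k j i hij hjk x := by
    simp only [extTransition_apply]
    rw [← Ext.comp_assoc _ _ _ (zero_add 0) (zero_add _) (by simp), Ext.mk₀_comp_mk₀,
      powQuotMap_comp]

/-- The direct limit of the modules `Ext^i(R ⧸ I ^ t, N)`. -/
abbrev extLimit (i : ℕ) (N : ModuleCat.{u} R) : Type u :=
  Module.DirectLimit (fun t ↦ Abelian.Ext (powQuot I t) N i) (extTransition I i N)

/-- The canonical map from `Ext^i(R ⧸ I ^ t, N)` to the direct limit. -/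
noncomputable abbrev extLimit.of (i : ℕ) (N : ModuleCat.{u} R) (t : ℕ) :
    Abelian.Ext (powQuot I t) N i →ₗ[R] extLimit I i N :=
  Module.DirectLimit.of R ℕ _ (extTransition I i N) t

/-- The canonical map from the derived functor to local cohomology. -/
noncomputable def localCohomologyι (i : ℕ) (N : ModuleCat.{u} R) (t : ℕ) :
    ((_root_.Ext R (ModuleCat.{u} R) i).obj (.op (powQuot I t))).obj N ⟶
      (localCohomology I i).obj N :=
  (colimit.ι (localCohomology.diagram (localCohomology.idealPowersDiagram I) i)
    (.op (.op t))).app N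

/-- The colimit cocone of modules defining local cohomology. -/
noncomputable def localCohomologyCocone (i : ℕ) (N : ModuleCat.{u} R) :
    Cocone (localCohomology.diagram (localCohomology.idealPowersDiagram I) i ⋙
      (evaluation _ _).obj N) :=
  ((evaluation _ _).obj N).mapCocone (colimit.cocone _)

/-- The cocone `localCohomologyCocone` is a colimit. -/
noncomputable def isColimitLocalCohomologyCocone (i : ℕ) (N : ModuleCat.{u} R) :
    IsColimit (localCohomologyCocone I i N) :=
  isColimitOfPreserves _ (colimit.isColimit _)

/-- The powers of `I` are indexed by `ℕ`, hence by a category in universe zero. -/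
instance : PreservesFilteredColimitsOfSize.{0, 0} (forget (ModuleCat.{u} R)) :=
  preservesFilteredColimitsOfSize_shrink.{0, u, 0, u} _

lemma localCohomologyι_jointly_surjective (i : ℕ) (N : ModuleCat.{u} R)
    (x : (localCohomology I i).obj N) : ∃ t y, localCohomologyι I i N t y = x := by
  obtain ⟨j, y, h⟩ := Concrete.isColimit_exists_rep _ (isColimitLocalCohomologyCocone I i N) x
  exact ⟨j.unop.unop, y, h⟩

lemma localCohomologyι_map (i : ℕ) (N : ModuleCat.{u} R) {s t : ℕ} (h : s ≤ t) (y) :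
    localCohomologyι I i N t
      (((_root_.Ext R (ModuleCat.{u} R) i).map (powQuotMap I h).op).app N y) =
        localCohomologyι I i N s y :=
  ConcreteCategory.congr_hom ((localCohomologyCocone I i N).w
    (Quiver.Hom.op (Quiver.Hom.op (homOfLE h)) : Opposite.op (Opposite.op s) ⟶ .op (.op t))) y

lemma exists_map_eq_zero_of_localCohomologyι_eq_zero (i : ℕ) (N : ModuleCat.{u} R) (s : ℕ) (y)
    (hy : localCohomologyι I i N s y = 0) : ∃ (t : ℕ) (h : s ≤ t),
      ((_root_.Ext R (ModuleCat.{u} R) i).map (powQuotMap I h).op).app N y = 0 := by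
  have hy' : (localCohomologyCocone I i N).ι.app (.op (.op s)) y =
      (localCohomologyCocone I i N).ι.app (.op (.op s)) 0 :=
    hy.trans (map_zero (localCohomologyι I i N s).hom).symm
  obtain ⟨k, f, g, h⟩ := Concrete.isColimit_exists_of_rep_eq _
    (isColimitLocalCohomologyCocone I i N) _ _ hy'
  have h0 := map_zero ((localCohomology.diagram (localCohomology.idealPowersDiagram I) i ⋙
      (evaluation _ _).obj N).map g).hom
  have hle : s ≤ k.unop.unop := leOfHom f.unop.unop
  exact ⟨k.unop.unop, hle, h.trans h0⟩

/-- Local cohomology is the direct limit of `Ext^i(R ⧸ I ^ t, N)`. -/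
lemma nonempty_localCohomology_equiv_extLimit (i : ℕ) (N : ModuleCat.{u} R) :
    Nonempty ((localCohomology I i).obj N ≃ₗ[R] extLimit I i N) := by
  let g (t : ℕ) : Abelian.Ext (powQuot I t) N i →ₗ[R] (localCohomology I i).obj N :=
    (localCohomologyι I i N t).hom ∘ₗ (extEquiv (powQuot I t) N i).symm.toLinearMap
  have hsymm (s t : ℕ) (h : s ≤ t) (x : Abelian.Ext (powQuot I s) N i) :
      (extEquiv (powQuot I t) N i).symm (extTransition I i N s t h x) =
        ((_root_.Ext R (ModuleCat.{u} R) i).map (powQuotMap I h).op).app N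
          ((extEquiv (powQuot I s) N i).symm x) := by
    rw [LinearEquiv.symm_apply_eq, extEquiv_naturality, LinearEquiv.apply_symm_apply,
      extTransition_apply]
  have hg (s t : ℕ) (h : s ≤ t) (x : Abelian.Ext (powQuot I s) N i) :
      g t (extTransition I i N s t h x) = g s x := by
    have := localCohomologyι_map I i N h ((extEquiv (powQuot I s) N i).symm x)
    rw [← hsymm] at this
    exact this
  refine ⟨(LinearEquiv.ofBijective (Module.DirectLimit.lift R ℕ _ _ g hg) ⟨?_, ?_⟩).symm⟩
  · rw [← LinearMap.ker_eq_bot, LinearMap.ker_eq_bot']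
    intro x hx
    obtain ⟨s, x, rfl⟩ := Module.DirectLimit.exists_of x
    rw [Module.DirectLimit.lift_of] at hx
    obtain ⟨t, h, ht⟩ := exists_map_eq_zero_of_localCohomologyι_eq_zero I i N s _ hx
    replace ht := (hsymm s t h x).trans ht
    rw [LinearEquiv.map_eq_zero_iff] at ht
    rw [← Module.DirectLimit.of_f (hij := h), ht, map_zero]
  · intro x
    obtain ⟨t, y, rfl⟩ := localCohomologyι_jointly_surjective I i N x
    refine ⟨extLimit.of I i N t (extEquiv _ N i y), ?_⟩
    rw [Module.DirectLimit.lift_of]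
    exact congrArg (localCohomologyι I i N t) (LinearEquiv.symm_apply_apply _ y)

end DirectLimit

/-! ### The long exact sequence of local cohomology. -/

section LongExactSequence

variable {R : Type u} [CommRing R] (I : Ideal R)

/-- The map on direct limits given by composition with a class in `Ext^m(N, N')`. -/
noncomputable def extLimit.postcomp {N N' : ModuleCat.{u} R} {m a b : ℕ}
    (β : Abelian.Ext N N' m) (h : a + m = b) : extLimit I a N →ₗ[R] extLimit I b N' :=
  Module.DirectLimit.map (fun t ↦ β.postcompOfLinear R (powQuot I t) h) (by
    intro s t hst
    ext x
    exact (Ext.comp_assoc _ _ _ (zero_add a) h (by omega)))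

lemma extLimit.postcomp_of {N N' : ModuleCat.{u} R} {m a b : ℕ}
    (β : Abelian.Ext N N' m) (h : a + m = b) (t : ℕ) (x : Abelian.Ext (powQuot I t) N a) :
    extLimit.postcomp I β h (extLimit.of I a N t x) = extLimit.of I b N' t (x.comp β h) :=
  Module.DirectLimit.map_apply_of _ _ _

lemma extLimit.exists_of {a : ℕ} {N : ModuleCat.{u} R} (x : extLimit I a N) :
    ∃ t y, extLimit.of I a N t y = x :=
  Module.DirectLimit.exists_of x

/-- Vanishing in the limit already happens at a finite stage, so a representative at a later stage
is itself killed. This carries exactness of the `Ext` sequences to the limit. -/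
lemma extLimit.exists_of_postcomp_eq_zero {N N' : ModuleCat.{u} R} {m a b : ℕ}
    (β : Abelian.Ext N N' m) (h : a + m = b) (x : extLimit I a N)
    (hx : extLimit.postcomp I β h x = 0) :
    ∃ (t : ℕ) (y : Abelian.Ext (powQuot I t) N a), extLimit.of I a N t y = x ∧ y.comp β h = 0 := by
  obtain ⟨s, y, rfl⟩ := extLimit.exists_of I x
  rw [extLimit.postcomp_of] at hx
  obtain ⟨t, hst, ht⟩ := Module.DirectLimit.of.zero_exact hx
  refine ⟨t, extTransition I a N s t hst y, Module.DirectLimit.of_f .., ?_⟩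
  rw [extTransition_apply] at ht ⊢
  rwa [Ext.comp_assoc _ _ _ (zero_add a) h (by omega)]

lemma extLimit.exact₂ {S : ShortComplex (ModuleCat.{u} R)} (hS : S.ShortExact) (a : ℕ)
    (x : extLimit I a S.X₂)
    (hx : extLimit.postcomp I (Ext.mk₀ S.g) (add_zero a) x = 0) :
    ∃ y : extLimit I a S.X₁, extLimit.postcomp I (Ext.mk₀ S.f) (add_zero a) y = x := by
  obtain ⟨t, y, rfl, hy⟩ := extLimit.exists_of_postcomp_eq_zero I _ _ x hx
  obtain ⟨z, rfl⟩ := Ext.covariant_sequence_exact₂ _ hS y hy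
  exact ⟨extLimit.of I a _ t z, extLimit.postcomp_of ..⟩

lemma extLimit.exact₃ {S : ShortComplex (ModuleCat.{u} R)} (hS : S.ShortExact) {a b : ℕ}
    (h : a + 1 = b) (x : extLimit I a S.X₃)
    (hx : extLimit.postcomp I hS.extClass h x = 0) :
    ∃ y : extLimit I a S.X₂, extLimit.postcomp I (Ext.mk₀ S.g) (add_zero a) y = x := by
  obtain ⟨t, y, rfl, hy⟩ := extLimit.exists_of_postcomp_eq_zero I _ _ x hx
  obtain ⟨z, rfl⟩ := Ext.covariant_sequence_exact₃ _ hS y h hy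
  exact ⟨extLimit.of I a _ t z, extLimit.postcomp_of ..⟩

lemma extLimit.exact₁ {S : ShortComplex (ModuleCat.{u} R)} (hS : S.ShortExact) {a b : ℕ}
    (h : a + 1 = b) (x : extLimit I b S.X₁)
    (hx : extLimit.postcomp I (Ext.mk₀ S.f) (add_zero b) x = 0) :
    ∃ y : extLimit I a S.X₃, extLimit.postcomp I hS.extClass h y = x := by
  obtain ⟨t, y, rfl, hy⟩ := extLimit.exists_of_postcomp_eq_zero I _ _ x hx
  obtain ⟨z, rfl⟩ := Ext.covariant_sequence_exact₁ _ hS y hy h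
  exact ⟨extLimit.of I a _ t z, extLimit.postcomp_of ..⟩

lemma extLimit.postcomp_extClass_postcomp {S : ShortComplex (ModuleCat.{u} R)}
    (hS : S.ShortExact) {a b : ℕ} (h : a + 1 = b) (x : extLimit I a S.X₂) :
    extLimit.postcomp I hS.extClass h
      (extLimit.postcomp I (Ext.mk₀ S.g) (add_zero a) x) = 0 := by
  obtain ⟨t, y, rfl⟩ := extLimit.exists_of I x
  rw [extLimit.postcomp_of, extLimit.postcomp_of,
    Ext.comp_assoc _ _ _ (add_zero a) (zero_add 1) (by omega), hS.comp_extClass,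
    Ext.comp_zero, map_zero]

lemma extLimit.postcomp_zero_injective {N N' : ModuleCat.{u} R} (f : N ⟶ N') [Mono f] :
    Function.Injective (extLimit.postcomp I (Ext.mk₀ f) (add_zero 0)) := by
  rw [← LinearMap.ker_eq_bot, LinearMap.ker_eq_bot']
  intro x hx
  obtain ⟨t, y, rfl, hy⟩ := extLimit.exists_of_postcomp_eq_zero I _ _ x hx
  have := Ext.postcomp_mk₀_injective_of_mono (powQuot I t) f (a₁ := y) (a₂ := 0) (by simpa using hy)
  rw [this, map_zero]

lemma extLimit.subsingleton_of_injective (i : ℕ) (E : ModuleCat.{u} R) [Injective E] :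
    Subsingleton (extLimit I (i + 1) E) := by
  refine subsingleton_of_forall_eq 0 fun x ↦ ?_
  obtain ⟨t, y, rfl⟩ := extLimit.exists_of I x
  rw [Ext.eq_zero_of_injective y, map_zero]

/-- Scalar multiplication on `Ext` is induced by scalar multiplication on the first argument, where
`a` acts as zero. -/
lemma smul_ext_powQuot (t i : ℕ) (N : ModuleCat.{u} R) (x : Abelian.Ext (powQuot I t) N i) {a : R}
    (ha : a ∈ I ^ t) : a • x = 0 := by
  have h : a • 𝟙 (powQuot I t) = 0 := by
    ext
    change a • Ideal.Quotient.mk (I ^ t) 1 = 0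
    rw [← Ideal.Quotient.mk_eq_mk, ← Submodule.Quotient.mk_smul, smul_eq_mul, mul_one]
    exact (Submodule.Quotient.mk_eq_zero _).2 ha
  have h2 : a • x = (Ext.mk₀ (a • 𝟙 (powQuot I t))).comp x (zero_add i) := by
    rw [Ext.mk₀_smul, Ext.smul_comp, Ext.mk₀_id_comp]
  rw [h2, h, Ext.mk₀_zero, Ext.zero_comp]

lemma extLimit.exists_pow_smul_eq_zero (i : ℕ) (N : ModuleCat.{u} R) (x : extLimit I i N) :
    ∃ t, ∀ a ∈ I ^ t, a • x = 0 := by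
  obtain ⟨t, y, rfl⟩ := extLimit.exists_of I x
  exact ⟨t, fun a ha ↦ by rw [← map_smul, smul_ext_powQuot I t i N y ha, map_zero]⟩

end LongExactSequence

/-! ### Degree zero: power torsion. -/

section Torsion

variable {R : Type u} [CommRing R] (I : Ideal R)

/-- The submodule of elements killed by a power of `I`. -/
def powTorsion (N : Type u) [AddCommGroup N] [Module R N] : Submodule R N where
  carrier := {x | ∃ t, ∀ a ∈ I ^ t, a • x = 0}
  add_mem' := by
    rintro x y ⟨s, hs⟩ ⟨t, ht⟩
    refine ⟨max s t, fun a ha ↦ ?_⟩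
    rw [smul_add, hs a (Ideal.pow_le_pow_right (le_max_left s t) ha),
      ht a (Ideal.pow_le_pow_right (le_max_right s t) ha), add_zero]
  zero_mem' := ⟨0, by simp⟩
  smul_mem' := by
    rintro r x ⟨s, hs⟩
    exact ⟨s, fun a ha ↦ by rw [smul_comm, hs a ha, smul_zero]⟩

/-- Evaluation at `1` as a linear map on `Ext^0(R ⧸ I ^ t, N)`. -/
noncomputable def extZeroEval (t : ℕ) (N : ModuleCat.{u} R) :
    Abelian.Ext (powQuot I t) N 0 →ₗ[R] N where
  toFun x := (Ext.linearEquiv₀ (R := R) x).hom (Submodule.Quotient.mk 1)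
  map_add' x y := by rw [map_add]; rfl
  map_smul' r x := by rw [map_smul]; rfl

lemma extZeroEval_mk₀ (t : ℕ) (N : ModuleCat.{u} R) (f : powQuot I t ⟶ N) :
    extZeroEval I t N (Ext.mk₀ f) = f.hom (Submodule.Quotient.mk 1) := by
  change (Ext.linearEquiv₀ (R := R) (Ext.mk₀ f)).hom _ = _
  rw [← Ext.linearEquiv₀_symm_apply (R := R), LinearEquiv.apply_symm_apply]

lemma exists_mk₀_eq {X Y : ModuleCat.{u} R} (x : Abelian.Ext X Y 0) : ∃ f, Ext.mk₀ f = x :=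
  ⟨_, Ext.mk₀_linearEquiv₀_apply (R := R) x⟩

/-- The map from the direct limit of `Hom(R ⧸ I ^ t, N)` to `N` given by evaluation at `1`. -/
noncomputable def extLimit.eval (N : ModuleCat.{u} R) : extLimit I 0 N →ₗ[R] N :=
  Module.DirectLimit.lift R ℕ _ _ (fun t ↦ extZeroEval I t N) (by
    intro s t h x
    obtain ⟨f, rfl⟩ := exists_mk₀_eq x
    rw [extTransition_apply, Ext.mk₀_comp_mk₀, extZeroEval_mk₀, extZeroEval_mk₀]
    rfl)

lemma extLimit.eval_of_mk₀ (N : ModuleCat.{u} R) (t : ℕ) (f : powQuot I t ⟶ N) :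
    extLimit.eval I N (extLimit.of I 0 N t (Ext.mk₀ f)) = f.hom (Submodule.Quotient.mk 1) := by
  rw [extLimit.eval, Module.DirectLimit.lift_of, extZeroEval_mk₀]

lemma extLimit.eval_injective (N : ModuleCat.{u} R) : Function.Injective (extLimit.eval I N) := by
  rw [← LinearMap.ker_eq_bot, LinearMap.ker_eq_bot']
  intro x hx
  obtain ⟨t, y, rfl⟩ := extLimit.exists_of I x
  obtain ⟨f, rfl⟩ := exists_mk₀_eq y
  rw [extLimit.eval_of_mk₀] at hx
  have : f = 0 := by
    ext
    exact hx
  rw [this, Ext.mk₀_zero, map_zero]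

/-- An element killed by `I ^ t` is the image of `1` under a map from `R ⧸ I ^ t`. -/
lemma extLimit.range_eval (N : ModuleCat.{u} R) :
    LinearMap.range (extLimit.eval I N) = powTorsion I N := by
  ext x
  constructor
  · rintro ⟨y, rfl⟩
    obtain ⟨t, ht⟩ := extLimit.exists_pow_smul_eq_zero I 0 N y
    exact ⟨t, fun a ha ↦ by rw [← map_smul, ht a ha, map_zero]⟩
  · rintro ⟨t, ht⟩
    refine ⟨extLimit.of I 0 N t (Ext.mk₀ (ModuleCat.ofHom
      ((I ^ t).liftQ (LinearMap.toSpanSingleton R N x) ?_))), ?_⟩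
    · intro a ha
      exact ht a ha
    · rw [extLimit.eval_of_mk₀]
      exact one_smul R x

lemma extLimit.eval_postcomp {N N' : ModuleCat.{u} R} (f : N ⟶ N') (x : extLimit I 0 N) :
    extLimit.eval I N' (extLimit.postcomp I (Ext.mk₀ f) (add_zero 0) x) =
      f.hom (extLimit.eval I N x) := by
  obtain ⟨t, y, rfl⟩ := extLimit.exists_of I x
  obtain ⟨g, rfl⟩ := exists_mk₀_eq y
  rw [extLimit.postcomp_of, Ext.mk₀_comp_mk₀, extLimit.eval_of_mk₀, extLimit.eval_of_mk₀]
  rfl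

/-- The zeroth local cohomology is the submodule of `I`-power torsion elements. -/
noncomputable def extLimit.zeroEquiv (N : ModuleCat.{u} R) : extLimit I 0 N ≃ₗ[R] powTorsion I N :=
  LinearEquiv.ofInjective _ (extLimit.eval_injective I N) ≪≫ₗ
    LinearEquiv.ofEq _ _ (extLimit.range_eval I N)

lemma extLimit.subsingleton_zero_iff (N : ModuleCat.{u} R) :
    Subsingleton (extLimit I 0 N) ↔ powTorsion I N = ⊥ := by
  rw [(extLimit.zeroEquiv I N).toEquiv.subsingleton_congr, Submodule.subsingleton_iff_eq_bot]

end Torsion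

/-! ### Torsion in injective modules, and acyclicity of torsion modules. -/

section InjectiveTorsion

variable {R : Type u} [CommRing R] (I : Ideal R)

lemma exists_pow_smul_eq_zero_of_fg {N : Type u} [AddCommGroup N] [Module R N]
    {W : Submodule R N} (hfg : W.FG) (hW : W ≤ powTorsion I N) :
    ∃ t, ∀ a ∈ I ^ t, ∀ w ∈ W, a • w = 0 := by
  obtain ⟨s, rfl⟩ := hfg
  have h (x : s) : ∃ t, ∀ a ∈ I ^ t, a • (x : N) = 0 := hW (Submodule.subset_span x.2)
  choose t ht using h
  refine ⟨Finset.univ.sup t, fun a ha w hw ↦ ?_⟩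
  induction hw using Submodule.span_induction with
  | mem x hx =>
    exact ht ⟨x, hx⟩ a (Ideal.pow_le_pow_right (Finset.le_sup (f := t) (Finset.mem_univ _)) ha)
  | zero => exact smul_zero a
  | add x y _ _ hx hy => rw [smul_add, hx, hy, add_zero]
  | smul r x _ hx => rw [smul_comm, hx, smul_zero]

/-- Over a noetherian ring the `I`-power torsion of an injective module is injective. -/
lemma injective_powTorsion [IsNoetherianRing R] (E : Type u) [AddCommGroup E] [Module R E]
    [hE : Module.Injective R E] : Module.Injective R (powTorsion I E) := by
  refine Module.Baer.injective fun J g ↦ ?_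
  -- By Baer's criterion it suffices to extend `g` from an ideal `J`. Since `J` is finitely
  -- generated, one power `I ^ t` kills the image of `g`.
  obtain ⟨t, ht⟩ := exists_pow_smul_eq_zero_of_fg I
    (W := LinearMap.range ((powTorsion I E).subtype ∘ₗ g))
    (by
      rw [LinearMap.range_eq_map]
      exact (IsNoetherian.noetherian (⊤ : Submodule R J)).map _) (by
      rintro _ ⟨x, rfl⟩
      exact (g x).2)
  -- Artin–Rees: `I ^ (k + t) ⊓ J ≤ I ^ t • J`, so `g` vanishes on this intersection.
  obtain ⟨k, hk⟩ := Ideal.exists_pow_inf_eq_pow_smul I J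
  have hker : (Submodule.comap J.subtype (I ^ (k + t))) ≤
      LinearMap.ker ((powTorsion I E).subtype ∘ₗ g) := by
    intro x hx
    have hx1 : (x : R) ∈ I ^ t • J := by
      have h1 : (x : R) ∈ I ^ (k + t) • (⊤ : Submodule R R) ⊓ J := by
        refine ⟨?_, x.2⟩
        rw [smul_eq_mul, Ideal.mul_top]
        exact hx
      rw [hk _ (Nat.le_add_right k t), Nat.add_sub_cancel_left] at h1
      exact smul_mono_right (I ^ t) (inf_le_right : _ ≤ J) h1
    have hx2 : x ∈ I ^ t • (⊤ : Submodule R J) := by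
      have h2 : (I ^ t • (⊤ : Submodule R J)).map J.subtype = I ^ t • J := by
        rw [Submodule.map_smul'', Submodule.map_subtype_top]
      rw [← h2] at hx1
      obtain ⟨y, hy, hyx⟩ := hx1
      rwa [← Subtype.ext hyx]
    refine Submodule.smul_induction_on hx2 (fun a ha y _ ↦ ?_) fun y z hy hz ↦ add_mem hy hz
    rw [LinearMap.mem_ker, map_smul]
    exact ht a ha _ ⟨y, rfl⟩
  -- `g` descends to `J / (J ∩ I ^ (k + t))`, which embeds in `R ⧸ I ^ (k + t)`. An extension to the
  -- latter has values killed by `I ^ (k + t)`, hence torsion.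
  obtain ⟨h, hh⟩ := hE.out (Submodule.mapQ (Submodule.comap J.subtype (I ^ (k + t)))
    (I ^ (k + t)) J.subtype le_rfl) (by
      rw [← LinearMap.ker_eq_bot, LinearMap.ker_eq_bot']
      intro x hx
      obtain ⟨x, rfl⟩ := Submodule.Quotient.mk_surjective _ x
      rw [Submodule.mapQ_apply, Submodule.Quotient.mk_eq_zero] at hx
      exact (Submodule.Quotient.mk_eq_zero _).2 hx) (Submodule.liftQ _ _ hker)
  refine ⟨(h ∘ₗ (Submodule.mkQ (I ^ (k + t)))).codRestrict _ fun r ↦ ⟨k + t, fun a ha ↦ ?_⟩,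
    fun x hx ↦ Subtype.ext (hh (Submodule.Quotient.mk ⟨x, hx⟩))⟩
  rw [LinearMap.comp_apply, ← map_smul, Submodule.mkQ_apply, ← Submodule.Quotient.mk_smul, smul_eq_mul,
    (Submodule.Quotient.mk_eq_zero _).2 (Ideal.mul_mem_right r _ ha), map_zero]

/-- The kernel is a direct summand of `E`, with projection `id - r`. -/
lemma injective_ker_of_retraction {E : Type u} [AddCommGroup E] [Module R E]
    [hE : Module.Injective R E] {W : Submodule R E} (r : E →ₗ[R] W) (hr : ∀ w : W, r w = w) :
    Module.Injective R (LinearMap.ker r) where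
  out X Y _ _ _ _ f hf g := by
    obtain ⟨h, hh⟩ := hE.out f hf ((LinearMap.ker r).subtype ∘ₗ g)
    refine ⟨((LinearMap.id - W.subtype ∘ₗ r) ∘ₗ h).codRestrict _ fun y ↦ ?_, fun x ↦ ?_⟩
    · simp [hr]
    · refine Subtype.ext ?_
      change h (f x) - (r (h (f x)) : E) = g x
      rw [hh x]
      change (g x : E) - (r (g x) : E) = g x
      rw [LinearMap.mem_ker.1 (g x).2, Submodule.coe_zero, sub_zero]

/-- The cokernel sequence of an injective map. -/
lemma exists_shortExact_of_injective {N E : ModuleCat.{u} R} (f : N ⟶ E)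
    (hf : Function.Injective f) :
    ∃ (C : ModuleCat.{u} R) (g : E ⟶ C) (w : f ≫ g = 0), (ShortComplex.mk f g w).ShortExact := by
  refine ⟨ModuleCat.of R (E ⧸ LinearMap.range f.hom),
    ModuleCat.ofHom (LinearMap.range f.hom).mkQ, ?_,
    ModuleCat.shortComplex_shortExact _ ?_ hf (Submodule.mkQ_surjective _)⟩
  · ext x
    exact (Submodule.Quotient.mk_eq_zero _).2 ⟨x, rfl⟩
  · intro x
    exact Submodule.Quotient.mk_eq_zero _

/-- A torsion free module embeds in a torsion free injective module. -/
lemma exists_shortExact_of_powTorsion_eq_bot [IsNoetherianRing R] (N : ModuleCat.{u} R)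
    (hN : powTorsion I N = ⊥) :
    ∃ (E C : ModuleCat.{u} R) (f : N ⟶ E) (g : E ⟶ C) (w : f ≫ g = 0),
      (ShortComplex.mk f g w).ShortExact ∧ Injective E ∧ powTorsion I E = ⊥ := by
  let E₀ := Injective.under N
  have : Module.Injective R E₀ :=
    haveI : Injective (ModuleCat.of R E₀) := inferInstanceAs (Injective (Injective.under N))
    Module.injective_module_of_injective_object R E₀
  have := injective_powTorsion I E₀
  -- The torsion of `E₀` is injective, hence a direct summand; its complement `ker r` is torsion
  -- free. Projecting `N` to this complement stays injective, because an element that dies there is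
  -- torsion.
  obtain ⟨r, hr⟩ := Module.Injective.out (R := R) (powTorsion I E₀).subtype
    (powTorsion I E₀).injective_subtype LinearMap.id
  have := injective_ker_of_retraction r hr
  let j : N →ₗ[R] E₀ := (Injective.ι N).hom
  have hj : Function.Injective j := (ModuleCat.mono_iff_injective _).1 (Injective.ι_mono N)
  let f : N →ₗ[R] LinearMap.ker r :=
    ((LinearMap.id - (powTorsion I E₀).subtype ∘ₗ r) ∘ₗ j).codRestrict _ fun y ↦ by
      rw [LinearMap.mem_ker]
      have := hr (r (j y))
      simp only [LinearMap.comp_apply, LinearMap.sub_apply, LinearMap.id_apply, map_sub] at this ⊢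
      rw [this, sub_self]
  have hf : Function.Injective f := by
    rw [← LinearMap.ker_eq_bot, LinearMap.ker_eq_bot']
    intro x hx
    have h1 : j x = r (j x) := sub_eq_zero.1 (congrArg Subtype.val hx)
    obtain ⟨t, ht⟩ := (r (j x)).2
    have : x ∈ powTorsion I N := ⟨t, fun a ha ↦ hj (by rw [map_smul, h1, ht a ha, map_zero])⟩
    rwa [hN] at this
  obtain ⟨C, g, w, hS⟩ := exists_shortExact_of_injective
    (E := ModuleCat.of R (LinearMap.ker r)) (ModuleCat.ofHom f) hf
  refine ⟨_, C, _, g, w, hS, Module.injective_object_of_injective_module R _, ?_⟩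
  rw [eq_bot_iff]
  rintro ⟨x, hx⟩ ⟨t, ht⟩
  have hx' : x ∈ powTorsion I E₀ := ⟨t, fun a ha ↦ congrArg Subtype.val (ht a ha)⟩
  have h2 := hr ⟨x, hx'⟩
  have h3 : (⟨x, hx'⟩ : powTorsion I E₀) = 0 := h2.symm.trans hx
  exact Subtype.ext (Subtype.ext_iff.1 h3 : x = 0)

/-- A torsion module embeds in a torsion injective module with torsion cokernel. -/
lemma exists_shortExact_of_powTorsion_eq_top [IsNoetherianRing R] (N : ModuleCat.{u} R)
    (hN : powTorsion I N = ⊤) :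
    ∃ (E C : ModuleCat.{u} R) (f : N ⟶ E) (g : E ⟶ C) (w : f ≫ g = 0),
      (ShortComplex.mk f g w).ShortExact ∧ Injective E ∧ powTorsion I E = ⊤ ∧
        powTorsion I C = ⊤ := by
  let E₀ := Injective.under N
  have : Module.Injective R E₀ :=
    haveI : Injective (ModuleCat.of R E₀) := inferInstanceAs (Injective (Injective.under N))
    Module.injective_module_of_injective_object R E₀
  have := injective_powTorsion I E₀
  let j : N →ₗ[R] E₀ := (Injective.ι N).hom
  have hj : Function.Injective j := (ModuleCat.mono_iff_injective _).1 (Injective.ι_mono N)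
  let f : N →ₗ[R] powTorsion I E₀ := j.codRestrict _ fun y ↦ by
    obtain ⟨t, ht⟩ : y ∈ powTorsion I N := hN ▸ Submodule.mem_top
    exact ⟨t, fun a ha ↦ by rw [← map_smul, ht a ha, map_zero]⟩
  obtain ⟨C, g, w, hS⟩ := exists_shortExact_of_injective
    (E := ModuleCat.of R (powTorsion I E₀)) (ModuleCat.ofHom f)
    fun x y h ↦ hj (congrArg Subtype.val h)
  have hE : powTorsion I (powTorsion I E₀) = ⊤ := by
    rw [eq_top_iff]
    rintro ⟨x, t, ht⟩ -
    exact ⟨t, fun a ha ↦ Subtype.ext (ht a ha)⟩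
  refine ⟨_, C, _, g, w, hS, Module.injective_object_of_injective_module R _, hE, ?_⟩
  rw [eq_top_iff]
  rintro x -
  obtain ⟨y, rfl⟩ := hS.moduleCat_surjective_g x
  obtain ⟨t, ht⟩ : y ∈ powTorsion I (powTorsion I E₀) := hE ▸ Submodule.mem_top
  exact ⟨t, fun a ha ↦ by
    change a • g.hom y = 0
    rw [← map_smul, ht a ha, map_zero]⟩

/-- Higher local cohomology of torsion modules vanishes. -/
lemma extLimit.subsingleton_of_powTorsion_eq_top [IsNoetherianRing R] (i : ℕ)
    (N : ModuleCat.{u} R) (hN : powTorsion I N = ⊤) : Subsingleton (extLimit I (i + 1) N) := by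
  induction i generalizing N with
  | zero =>
    obtain ⟨E, C, f, g, w, hS, hE, hE', hC⟩ := exists_shortExact_of_powTorsion_eq_top I N hN
    refine subsingleton_of_forall_eq 0 fun x ↦ ?_
    have := extLimit.subsingleton_of_injective I 0 E
    obtain ⟨y, rfl⟩ := extLimit.exact₁ I hS (zero_add 1) x (Subsingleton.elim _ _)
    -- `E` and `C` are torsion, so in degree zero their cohomology is all of `E` and `C`.
    -- Surjectivity of `E → C` then lifts `y`, and the connecting map kills it.
    obtain ⟨e, he⟩ := hS.moduleCat_surjective_g (extLimit.eval I C y)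
    obtain ⟨z, rfl⟩ : e ∈ LinearMap.range (extLimit.eval I E) := by
      rw [extLimit.range_eval, hE']
      exact Submodule.mem_top
    have hz : extLimit.postcomp I (Ext.mk₀ g) (add_zero 0) z = y :=
      extLimit.eval_injective I C ((extLimit.eval_postcomp I g z).trans he)
    rw [← hz]
    exact extLimit.postcomp_extClass_postcomp I hS _ z
  | succ i ih =>
    obtain ⟨E, C, f, g, w, hS, hE, hE', hC⟩ := exists_shortExact_of_powTorsion_eq_top I N hN
    refine subsingleton_of_forall_eq 0 fun x ↦ ?_
    have := extLimit.subsingleton_of_injective I (i + 1) E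
    obtain ⟨y, rfl⟩ := extLimit.exact₁ I hS rfl x (Subsingleton.elim _ _)
    have := ih C hC
    rw [Subsingleton.elim y 0, map_zero]

end InjectiveTorsion

/-! ### `Ext` of local cohomology concentrated in one degree. -/

section Comparison

variable {R : Type u} [CommRing R] (I : Ideal R)

/-- A linear equivalence of modules induces a linear equivalence of `Ext` modules. -/
noncomputable def extCongr (X : ModuleCat.{u} R) {N N' : ModuleCat.{u} R} (e : N ≃ₗ[R] N') (i : ℕ) :
    Abelian.Ext X N i ≃ₗ[R] Abelian.Ext X N' i :=
  LinearEquiv.ofLinearMap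
    ((Ext.mk₀ (ModuleCat.ofHom e.toLinearMap)).postcompOfLinear R X (add_zero i))
    ((Ext.mk₀ (ModuleCat.ofHom e.symm.toLinearMap)).postcompOfLinear R X (add_zero i))
    (by
      ext x
      change (x.comp _ (add_zero i)).comp _ (add_zero i) = x
      rw [Ext.comp_assoc _ _ _ _ (zero_add 0) (by omega), Ext.mk₀_comp_mk₀, ← ModuleCat.ofHom_comp,
        LinearEquiv.comp_symm]
      exact Ext.comp_mk₀_id _)
    (by
      ext x
      change (x.comp _ (add_zero i)).comp _ (add_zero i) = x
      rw [Ext.comp_assoc _ _ _ _ (zero_add 0) (by omega), Ext.mk₀_comp_mk₀, ← ModuleCat.ofHom_comp,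
        LinearEquiv.symm_comp]
      exact Ext.comp_mk₀_id _)

/-- A linear equivalence of modules induces a linear equivalence on the direct limits of `Ext`. -/
lemma extLimit.nonempty_congr {N N' : ModuleCat.{u} R} (e : N ≃ₗ[R] N') (i : ℕ) :
    Nonempty (extLimit I i N ≃ₗ[R] extLimit I i N') :=
  ⟨Module.DirectLimit.congr (fun t ↦ extCongr (powQuot I t) e i) (by
    intro s t hst
    ext x
    exact Ext.comp_assoc _ _ _ (zero_add i) (add_zero i) (by omega))⟩

/-- Dimension shifting along a short exact sequence with `Ext`-acyclic middle term. -/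
lemma nonempty_ext_equiv_succ (X : ModuleCat.{u} R) {S : ShortComplex (ModuleCat.{u} R)}
    (hS : S.ShortExact) (h : ∀ i, Subsingleton (Abelian.Ext X S.X₂ i)) (i : ℕ) :
    Nonempty (Abelian.Ext X S.X₃ i ≃ₗ[R] Abelian.Ext X S.X₁ (i + 1)) := by
  refine ⟨LinearEquiv.ofBijective (hS.extClass.postcompOfLinear R X rfl) ⟨?_, fun x ↦ ?_⟩⟩
  · rw [← LinearMap.ker_eq_bot, LinearMap.ker_eq_bot']
    intro x hx
    obtain ⟨y, rfl⟩ := Ext.covariant_sequence_exact₃ X hS x rfl hx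
    rw [Subsingleton.elim y 0, Ext.zero_comp]
  · exact Ext.covariant_sequence_exact₁ X hS x (Subsingleton.elim _ _) rfl

/-- Dimension shifting along a short exact sequence with acyclic middle term. -/
lemma extLimit.nonempty_equiv_succ {S : ShortComplex (ModuleCat.{u} R)}
    (hS : S.ShortExact) (h : ∀ i, Subsingleton (extLimit I i S.X₂)) (i : ℕ) :
    Nonempty (extLimit I i S.X₃ ≃ₗ[R] extLimit I (i + 1) S.X₁) := by
  refine ⟨LinearEquiv.ofBijective (extLimit.postcomp I hS.extClass rfl) ⟨?_, fun x ↦ ?_⟩⟩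
  · rw [← LinearMap.ker_eq_bot, LinearMap.ker_eq_bot']
    intro x hx
    obtain ⟨y, rfl⟩ := extLimit.exact₃ I hS rfl x hx
    rw [Subsingleton.elim y 0, map_zero]
  · exact extLimit.exact₁ I hS rfl x (Subsingleton.elim _ _)

/-- Isomorphism of `Ext` modules from a short exact sequence with `Ext`-acyclic quotient. -/
lemma nonempty_ext_equiv_of_subsingleton (X : ModuleCat.{u} R)
    {S : ShortComplex (ModuleCat.{u} R)} (hS : S.ShortExact)
    (h : ∀ i, Subsingleton (Abelian.Ext X S.X₃ i)) (i : ℕ) :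
    Nonempty (Abelian.Ext X S.X₁ i ≃ₗ[R] Abelian.Ext X S.X₂ i) := by
  have := hS.mono_f
  refine ⟨LinearEquiv.ofBijective ((Ext.mk₀ S.f).postcompOfLinear R X (add_zero i)) ⟨?_, fun x ↦ ?_⟩⟩
  · rcases i with - | i
    · exact Ext.postcomp_mk₀_injective_of_mono X S.f
    · rw [← LinearMap.ker_eq_bot, LinearMap.ker_eq_bot']
      intro x hx
      obtain ⟨y, rfl⟩ := Ext.covariant_sequence_exact₁ X hS x hx rfl
      rw [Subsingleton.elim y 0, Ext.zero_comp]
  · exact Ext.covariant_sequence_exact₂ X hS x (Subsingleton.elim _ _)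

lemma extLimit.subsingleton_of_injective_of_powTorsion_eq_bot (E : ModuleCat.{u} R) [Injective E]
    (hE : powTorsion I E = ⊥) (i : ℕ) : Subsingleton (extLimit I i E) := by
  rcases i with - | i
  · exact (extLimit.subsingleton_zero_iff I E).2 hE
  · exact extLimit.subsingleton_of_injective I i E

lemma subsingleton_ext_zero_of_powTorsion_eq_bot (N : ModuleCat.{u} R) (hN : powTorsion I N = ⊥) :
    Subsingleton (Abelian.Ext (ModuleCat.of R (R ⧸ I)) N 0) := by
  refine subsingleton_of_forall_eq 0 fun x ↦ ?_
  obtain ⟨f, rfl⟩ := exists_mk₀_eq x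
  have h1 : f.hom (Submodule.Quotient.mk 1) ∈ powTorsion I N := ⟨1, fun a ha ↦ by
    rw [pow_one] at ha
    rw [← map_smul, ← Submodule.Quotient.mk_smul, smul_eq_mul, mul_one,
      (Submodule.Quotient.mk_eq_zero _).2 ha, map_zero]⟩
  rw [hN, Submodule.mem_bot] at h1
  have : f = 0 := by
    ext
    exact h1
  rw [this, Ext.mk₀_zero]

lemma subsingleton_ext_of_injective_of_powTorsion_eq_bot (E : ModuleCat.{u} R) [Injective E]
    (hE : powTorsion I E = ⊥) (i : ℕ) :
    Subsingleton (Abelian.Ext (ModuleCat.of R (R ⧸ I)) E i) := by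
  rcases i with - | i
  · exact subsingleton_ext_zero_of_powTorsion_eq_bot I E hE
  · exact Ext.subsingleton_of_injective _ _ _

/-- If all local cohomology vanishes, then all `Ext^i(R ⧸ I, N)` vanish. -/
lemma subsingleton_ext_of_subsingleton_extLimit [IsNoetherianRing R] (i : ℕ) (N : ModuleCat.{u} R)
    (hN : ∀ j, Subsingleton (extLimit I j N)) :
    Subsingleton (Abelian.Ext (ModuleCat.of R (R ⧸ I)) N i) := by
  induction i generalizing N with
  | zero =>
    exact subsingleton_ext_zero_of_powTorsion_eq_bot I N
      ((extLimit.subsingleton_zero_iff I N).1 (hN 0))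
  | succ i ih =>
    -- `E` is acyclic both for local cohomology and for `Ext(R ⧸ I, -)`, so passing from `N` to `C`
    -- lowers the degree by one on both sides.
    obtain ⟨E, C, f, g, w, hS, hE, hE'⟩ := exists_shortExact_of_powTorsion_eq_bot I N
      ((extLimit.subsingleton_zero_iff I N).1 (hN 0))
    have hC := ih C fun j ↦ by
      obtain ⟨e⟩ := extLimit.nonempty_equiv_succ I hS
        (extLimit.subsingleton_of_injective_of_powTorsion_eq_bot I E hE') j
      have := hN (j + 1)
      exact e.toEquiv.subsingleton
    obtain ⟨e⟩ := nonempty_ext_equiv_succ (ModuleCat.of R (R ⧸ I)) hS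
        (subsingleton_ext_of_injective_of_powTorsion_eq_bot I E hE') i
    exact e.symm.toEquiv.subsingleton

/-- If the local cohomology of `N` is concentrated in degree `q`, then
`Ext^i(R ⧸ I, H^q_I(N)) ≃ Ext^(i+q)(R ⧸ I, N)`. -/
lemma nonempty_ext_extLimit_equiv [IsNoetherianRing R] (q : ℕ) (N : ModuleCat.{u} R)
    (hN : ∀ j, j ≠ q → Subsingleton (extLimit I j N)) (i : ℕ) :
    Nonempty (Abelian.Ext (ModuleCat.of R (R ⧸ I)) (ModuleCat.of R (extLimit I q N)) i ≃ₗ[R]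
      Abelian.Ext (ModuleCat.of R (R ⧸ I)) N (i + q)) := by
  induction q generalizing N with
  | zero =>
    -- Dividing `N` by its torsion leaves a module `C` without any local cohomology, so `Ext(R ⧸ I,
    -- -)` does not distinguish `N` from its torsion.
    obtain ⟨C, g, w, hS⟩ := exists_shortExact_of_injective
      (N := ModuleCat.of R (powTorsion I N)) (E := N)
      (ModuleCat.ofHom (powTorsion I N).subtype) (powTorsion I N).injective_subtype
    have hT : powTorsion I (powTorsion I N) = ⊤ := by
      rw [eq_top_iff]
      rintro ⟨x, t, ht⟩ -
      exact ⟨t, fun a ha ↦ Subtype.ext (ht a ha)⟩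
    have hC (j : ℕ) : Subsingleton (extLimit I j C) := by
      refine subsingleton_of_forall_eq 0 fun x ↦ ?_
      have := extLimit.subsingleton_of_powTorsion_eq_top I j
        (ModuleCat.of R (powTorsion I N)) hT
      obtain ⟨y, rfl⟩ := extLimit.exact₃ I hS rfl x (Subsingleton.elim _ _)
      rcases j with - | j
      · apply extLimit.eval_injective
        refine (extLimit.eval_postcomp I g y).trans ?_
        rw [map_zero]
        -- A class in degree zero that lifts to `N` evaluates to a torsion element, which dies in
        -- `C`.
        have hy : extLimit.eval I N y ∈ powTorsion I N := by
          rw [← extLimit.range_eval]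
          exact ⟨y, rfl⟩
        exact ConcreteCategory.congr_hom w ⟨_, hy⟩
      · have := hN (j + 1) (Nat.succ_ne_zero j)
        rw [Subsingleton.elim y 0, map_zero]
    obtain ⟨e⟩ := nonempty_ext_equiv_of_subsingleton (ModuleCat.of R (R ⧸ I)) hS
      (fun j ↦ subsingleton_ext_of_subsingleton_extLimit I j C hC) i
    exact ⟨(extCongr (N' := ModuleCat.of R (powTorsion I N)) _ (extLimit.zeroEquiv I N) i).trans e⟩
  | succ q ih =>
    obtain ⟨E, C, f, g, w, hS, hE, hE'⟩ := exists_shortExact_of_powTorsion_eq_bot I N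
      ((extLimit.subsingleton_zero_iff I N).1 (hN 0 (Nat.succ_ne_zero q).symm))
    -- The cokernel `C` is concentrated in degree `q`, and its `H^q` is `H^(q+1)` of `N`.
    have hδ := extLimit.nonempty_equiv_succ I hS
        (extLimit.subsingleton_of_injective_of_powTorsion_eq_bot I E hE')
    obtain ⟨e1⟩ := ih C fun j hj ↦ by
      obtain ⟨e⟩ := hδ j
      have := hN (j + 1) (by omega)
      exact e.toEquiv.subsingleton
    obtain ⟨e2⟩ := nonempty_ext_equiv_succ (ModuleCat.of R (R ⧸ I)) hS
        (subsingleton_ext_of_injective_of_powTorsion_eq_bot I E hE') (i + q)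
    obtain ⟨e3⟩ := hδ q
    exact ⟨(extCongr (N := ModuleCat.of R (extLimit I (q + 1) N))
      (N' := ModuleCat.of R (extLimit I q C)) _ e3.symm i).trans (e1.trans e2)⟩

end Comparison

/-! ### `Ext` out of the quotient by a set of variables. -/

section Variables

variable {K : Type u} [Field K] {σ : Type}

/-- The ideal generated by a finite set of variables. -/
noncomputable def variableIdeal (K : Type u) [Field K] (s : Finset σ) : Ideal (MvPolynomial σ K) :=
  Ideal.span (MvPolynomial.X '' (s : Set σ))

lemma mem_variableIdeal {s : Finset σ} {p : MvPolynomial σ K} :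
    p ∈ variableIdeal K s ↔ ∀ m ∈ p.support, ∃ i ∈ s, m i ≠ 0 := by
  rw [variableIdeal, MvPolynomial.mem_ideal_span_X_image]
  rfl

/-- Membership is tested on monomials, and multiplying by `X j` leaves the exponents of the
variables in `s` unchanged. -/
lemma mem_variableIdeal_of_X_mul {s : Finset σ} {j : σ} (hj : j ∉ s) {p : MvPolynomial σ K}
    (hp : MvPolynomial.X j * p ∈ variableIdeal K s) : p ∈ variableIdeal K s := by
  classical
  rw [mem_variableIdeal] at hp ⊢
  intro m hm
  obtain ⟨i, hi, h⟩ := hp (Finsupp.single j 1 + m) (by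
    rw [MvPolynomial.mem_support_iff, MvPolynomial.coeff_X_mul]
    exact MvPolynomial.mem_support_iff.1 hm)
  refine ⟨i, hi, ?_⟩
  have hij : j ≠ i := fun h ↦ hj (h ▸ hi)
  simpa [Finsupp.single_apply, hij] using h

lemma variableIdeal_insert [DecidableEq σ] (s : Finset σ) (j : σ) :
    variableIdeal K (insert j s) = Ideal.span {MvPolynomial.X j} ⊔ variableIdeal K s := by
  rw [variableIdeal, variableIdeal, Finset.coe_insert, Set.image_insert_eq, Ideal.span_insert]

lemma variableIdeal_le_insert [DecidableEq σ] (s : Finset σ) (j : σ) :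
    variableIdeal K s ≤ variableIdeal K (insert j s) := by
  rw [variableIdeal_insert]
  exact le_sup_right

lemma X_mem_variableIdeal_insert [DecidableEq σ] (s : Finset σ) (j : σ) :
    MvPolynomial.X j ∈ variableIdeal K (insert j s) := by
  rw [variableIdeal_insert]
  exact Ideal.mem_sup_left (Ideal.mem_span_singleton_self _)

/-- The quotient of the polynomial ring by a finite set of variables, as a module. -/
noncomputable abbrev variableQuot (K : Type u) [Field K] (s : Finset σ) :
    ModuleCat.{u} (MvPolynomial σ K) :=
  ModuleCat.of _ (MvPolynomial σ K ⧸ variableIdeal K s)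

/-- Killing no variable gives the polynomial ring. -/
noncomputable def variableQuotEmptyEquiv (K : Type u) [Field K] (σ : Type) :
    (MvPolynomial σ K ⧸ variableIdeal K (∅ : Finset σ)) ≃ₗ[MvPolynomial σ K] MvPolynomial σ K :=
  Submodule.quotEquivOfEqBot _ (by simp [variableIdeal])

/-- The projection killing one more variable. -/
noncomputable def variableQuotMap [DecidableEq σ] (s : Finset σ) (j : σ) :
    variableQuot K s ⟶ variableQuot K (insert j s) :=
  ModuleCat.ofHom (Submodule.mapQ _ _ LinearMap.id (variableIdeal_le_insert s j))

lemma X_smul_comp_variableQuotMap [DecidableEq σ] (s : Finset σ) (j : σ) :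
    ((MvPolynomial.X j : MvPolynomial σ K) • 𝟙 (variableQuot K s)) ≫ variableQuotMap s j = 0 := by
  ext
  change Submodule.Quotient.mk (MvPolynomial.X j * 1) = _
  rw [mul_one]
  exact (Submodule.Quotient.mk_eq_zero _).2 (X_mem_variableIdeal_insert s j)

/-- Multiplication by a new variable and the projection form a short exact sequence. -/
lemma shortExact_variableQuotMap [DecidableEq σ] {s : Finset σ} {j : σ} (hj : j ∉ s) :
    (ShortComplex.mk _ _ (X_smul_comp_variableQuotMap (K := K) s j)).ShortExact := by
  refine ModuleCat.shortComplex_shortExact _ (fun x ↦ ⟨fun hx ↦ ?_, ?_⟩) ?_ ?_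
  · obtain ⟨p, rfl⟩ := Submodule.Quotient.mk_surjective _ x
    have hp : p ∈ variableIdeal K (insert j s) := (Submodule.Quotient.mk_eq_zero _).1 hx
    rw [variableIdeal_insert, Submodule.mem_sup] at hp
    obtain ⟨a, ha, b, hb, rfl⟩ := hp
    obtain ⟨c, rfl⟩ := Ideal.mem_span_singleton'.1 ha
    refine ⟨Submodule.Quotient.mk c, ?_⟩
    change Submodule.Quotient.mk (MvPolynomial.X j * c) = Submodule.Quotient.mk _
    rw [Submodule.Quotient.eq, mul_comm, sub_add_cancel_left]
    exact neg_mem hb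
  · rintro ⟨y, rfl⟩
    exact ConcreteCategory.congr_hom (X_smul_comp_variableQuotMap (K := K) s j) y
  · change Function.Injective (fun x : variableQuot K s ↦ (MvPolynomial.X j : MvPolynomial σ K) • x)
    intro x y hxy
    obtain ⟨p, rfl⟩ := Submodule.Quotient.mk_surjective _ x
    obtain ⟨q, rfl⟩ := Submodule.Quotient.mk_surjective _ y
    have h : Submodule.Quotient.mk (p := variableIdeal K s) (MvPolynomial.X j * p) =
      Submodule.Quotient.mk (MvPolynomial.X j * q) := hxy
    rw [Submodule.Quotient.eq, ← mul_sub] at h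
    exact (Submodule.Quotient.eq _).2 (mem_variableIdeal_of_X_mul hj h)
  · intro x
    obtain ⟨p, rfl⟩ := Submodule.Quotient.mk_surjective _ x
    exact ⟨Submodule.Quotient.mk p, rfl⟩

/-- `Ext^i(S ⧸ (X_j : j ∈ s), N)` vanishes for `i > |s|`. -/
lemma subsingleton_ext_variableQuot (s : Finset σ) (N : ModuleCat.{u} (MvPolynomial σ K)) (i : ℕ)
    (hi : s.card < i) : Subsingleton (Abelian.Ext (variableQuot K s) N i) := by
  classical
  induction s using Finset.induction_on generalizing i with
  | empty =>
    have : Module.Projective (MvPolynomial σ K)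
        (MvPolynomial σ K ⧸ variableIdeal K (∅ : Finset σ)) := Module.Projective.of_equiv (variableQuotEmptyEquiv K σ).symm
    have : Projective (variableQuot K (∅ : Finset σ)) :=
      ModuleCat.projective_of_categoryTheory_projective _
    obtain ⟨i, rfl⟩ := Nat.exists_eq_succ_of_ne_zero (Nat.pos_of_ne_zero (by omega : i ≠ 0)).ne'
    exact Ext.subsingleton_of_projective _ _ _
  | insert j s hj ih =>
    rw [Finset.card_insert_of_notMem hj] at hi
    refine subsingleton_of_forall_eq 0 fun x ↦ ?_
    have h1 := ih i (by omega)
    obtain ⟨i, rfl⟩ := Nat.exists_eq_add_of_le' (by omega : 1 ≤ i)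
    -- `x` restricts to zero in `Ext^(i+1)` for `s`, so it comes from `Ext^i` for `s`, which
    -- vanishes too: one more variable costs one degree.
    obtain ⟨y, rfl⟩ := Ext.contravariant_sequence_exact₃ (shortExact_variableQuotMap hj) N x
      (Subsingleton.elim _ _) (add_comm 1 i)
    have h2 := ih i (by omega)
    rw [Subsingleton.elim y 0, Ext.comp_zero]

/-- `Ext^|s|(S ⧸ (X_j : j ∈ s), N)` is a quotient of `N` by a submodule of `(X_j : j ∈ s) N`. -/
lemma exists_surjective_ext_variableQuot (s : Finset σ) (N : ModuleCat.{u} (MvPolynomial σ K)) :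
    ∃ φ : N →ₗ[MvPolynomial σ K] Abelian.Ext (variableQuot K s) N s.card,
      Function.Surjective φ ∧ LinearMap.ker φ ≤ variableIdeal K s • ⊤ := by
  classical
  induction s using Finset.induction_on with
  | empty =>
    let e₁ : N ≃ₗ[MvPolynomial σ K]
        ((MvPolynomial σ K ⧸ variableIdeal K (∅ : Finset σ)) →ₗ[MvPolynomial σ K] N) :=
      (LinearMap.ringLmapEquivSelf (MvPolynomial σ K) (MvPolynomial σ K) N).symm ≪≫ₗ
        LinearEquiv.congrLeft _ _ (variableQuotEmptyEquiv K σ).symm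
    let e₂ : (variableQuot K (∅ : Finset σ) ⟶ N) ≃ₗ[MvPolynomial σ K]
        ((MvPolynomial σ K ⧸ variableIdeal K (∅ : Finset σ)) →ₗ[MvPolynomial σ K] N) :=
      ModuleCat.homLinearEquiv
    let e' : N ≃ₗ[MvPolynomial σ K] Abelian.Ext (variableQuot K (∅ : Finset σ)) N 0 :=
      e₁ ≪≫ₗ e₂.symm ≪≫ₗ Ext.linearEquiv₀.symm
    exact ⟨e'.toLinearMap, e'.surjective, fun x hx ↦ by
      rw [e'.map_eq_zero_iff.1 hx]
      exact zero_mem _⟩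
  | insert j s hj ih =>
    obtain ⟨φ, hφ, hker⟩ := ih
    have hS := shortExact_variableQuotMap (K := K) hj
    rw [Finset.card_insert_of_notMem hj]
    refine ⟨hS.extClass.precompOfLinear (MvPolynomial σ K) N (add_comm 1 s.card) ∘ₗ φ, ?_, ?_⟩
    · rw [LinearMap.coe_comp]
      refine Function.Surjective.comp (fun x ↦ ?_) hφ
      have := subsingleton_ext_variableQuot s N (s.card + 1) (Nat.lt_succ_self _)
      exact Ext.contravariant_sequence_exact₃ hS N x (Subsingleton.elim _ _) (add_comm 1 s.card)
    · intro x hx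
      -- The kernel of the connecting map is `X j` times the `Ext` for `s`. Hence `x - X j • z` lies
      -- in `ker φ` for a suitable `z`.
      obtain ⟨y, hy⟩ := Ext.contravariant_sequence_exact₁ hS N (φ x) (add_comm 1 s.card) hx
      obtain ⟨z, rfl⟩ := hφ y
      have h : φ x = φ ((MvPolynomial.X j : MvPolynomial σ K) • z) := by
        rw [← hy, Ext.mk₀_smul, Ext.smul_comp, Ext.mk₀_id_comp, map_smul]
      have h2 := hker (LinearMap.sub_mem_ker_iff.2 h)
      have h3 := add_mem (Submodule.smul_mono_left (variableIdeal_le_insert s j) h2)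
        (Submodule.smul_mem_smul (X_mem_variableIdeal_insert (K := K) s j)
          (Submodule.mem_top (x := z)))
      rwa [sub_add_cancel] at h3

end Variables

/-! ### Modules with local cohomology in a single degree. -/

section RelativeCohenMacaulay

variable {R : Type u} [CommRing R] (I : Ideal R)

lemma nonempty_H_equiv_extLimit (k : ℕ) (N : Type u) [AddCommGroup N] [Module R N] :
    Nonempty (H I k N ≃ₗ[R] extLimit I k (ModuleCat.of R N)) :=
  nonempty_localCohomology_equiv_extLimit I k _

lemma subsingleton_H_iff (k : ℕ) (N : Type u) [AddCommGroup N] [Module R N] :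
    Subsingleton (H I k N) ↔ Subsingleton (extLimit I k (ModuleCat.of R N)) :=
  (nonempty_H_equiv_extLimit I k N).some.toEquiv.subsingleton_congr

lemma H_exists_pow_smul_eq_zero (k : ℕ) (N : Type u) [AddCommGroup N] [Module R N] (x : H I k N) :
    ∃ t, ∀ a ∈ I ^ t, a • x = 0 := by
  obtain ⟨e⟩ := nonempty_H_equiv_extLimit I k N
  obtain ⟨t, ht⟩ := extLimit.exists_pow_smul_eq_zero I k _ (e x)
  exact ⟨t, fun a ha ↦ e.injective (by rw [map_smul, ht a ha, map_zero])⟩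

lemma support_H_subset (k : ℕ) (N : Type u) [AddCommGroup N] [Module R N] :
    Module.support R (H I k N) ⊆ PrimeSpectrum.zeroLocus (I : Set R) := by
  intro p hp
  obtain ⟨x, hx⟩ := Module.mem_support_iff_exists_annihilator.1 hp
  obtain ⟨t, ht⟩ := H_exists_pow_smul_eq_zero I k N x
  have h : I ^ t ≤ p.asIdeal := fun a ha ↦ hx ((Submodule.mem_annihilator_span_singleton x a).2
    (ht a ha))
  exact p.isPrime.le_of_pow_le h

/-- `N` has local cohomology exactly in degree `c`. -/
def IsConcentrated (c : ℕ) (N : Type u) [AddCommGroup N] [Module R N] : Prop :=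
  Nontrivial (H I c N) ∧ ∀ j, j ≠ c → Subsingleton (H I j N)

variable {I}

lemma IsConcentrated.cd_eq {c : ℕ} {N : Type u} [AddCommGroup N] [Module R N]
    (h : IsConcentrated I c N) : cd I N = ((c : ℕ∞) : WithBot ℕ∞) := by
  have : {d : WithBot ℕ∞ | ∃ i : ℕ, Nontrivial (H I i N) ∧ d = ((i : ℕ∞) : WithBot ℕ∞)} =
      {((c : ℕ∞) : WithBot ℕ∞)} := by
    ext d
    constructor
    · rintro ⟨i, hi, rfl⟩
      obtain rfl : i = c := by
        by_contra hic
        exact not_subsingleton _ (h.2 i hic)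
      rfl
    · rintro rfl
      exact ⟨c, h.1, rfl⟩
  rw [cd, this, sSup_singleton]

/-- If all cohomology vanished, `cd` would be the supremum of the empty set, `⊥`, against `h0`. So
some degree is nonzero and must equal `q`. -/
lemma exists_isConcentrated {N : Type u} [AddCommGroup N] [Module R N]
    (h : IsRelCohenMacaulay I N) (h0 : 0 ≤ cd I N) : ∃ c, IsConcentrated I c N := by
  obtain ⟨q, hq⟩ := h
  have hex : ∃ i, Nontrivial (H I i N) := by
    by_contra hne
    push Not at hne
    have : {d : WithBot ℕ∞ | ∃ i : ℕ, Nontrivial (H I i N) ∧ d = ((i : ℕ∞) : WithBot ℕ∞)} = ∅ := by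
      ext d
      simp only [Set.mem_ofPred_eq, Set.mem_empty_iff_false, iff_false, not_exists, not_and]
      exact fun i hi ↦ (not_subsingleton _ (hne i)).elim
    rw [cd, this, sSup_empty] at h0
    exact absurd h0 (by simp)
  obtain ⟨c, hc⟩ := hex
  have hcq : (c : ℤ) = q := by
    by_contra hcq
    exact not_subsingleton _ (hq c hcq)
  exact ⟨c, hc, fun j hj ↦ hq j (by omega)⟩

lemma IsConcentrated.nonempty_ext_equiv [IsNoetherianRing R] {c : ℕ} {N : Type u} [AddCommGroup N]
    [Module R N] (h : IsConcentrated I c N) (i : ℕ) :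
    Nonempty (Abelian.Ext (ModuleCat.of R (R ⧸ I)) (H I c N) i ≃ₗ[R]
      Abelian.Ext (ModuleCat.of R (R ⧸ I)) (ModuleCat.of R N) (i + c)) := by
  obtain ⟨e⟩ := nonempty_H_equiv_extLimit I c N
  obtain ⟨e'⟩ := nonempty_ext_extLimit_equiv I c (ModuleCat.of R N)
    (fun j hj ↦ (subsingleton_H_iff I j N).1 (h.2 j hj)) i
  exact ⟨(extCongr (N' := ModuleCat.of R (extLimit I c (ModuleCat.of R N))) _ e i).trans e'⟩

/-- After the degree shift this is `Ext` between finitely generated modules over a noetherian ring.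
-/
lemma IsConcentrated.finite_ext [IsNoetherianRing R] {c : ℕ} {N : Type u} [AddCommGroup N]
    [Module R N] [Module.Finite R N] (h : IsConcentrated I c N) (i : ℕ) :
    Module.Finite R (Abelian.Ext (ModuleCat.of R (R ⧸ I)) (H I c N) i) := by
  obtain ⟨e⟩ := h.nonempty_ext_equiv i
  have : Module.Finite R (ModuleCat.of R N) := ‹_›
  have : Module.Finite R (ModuleCat.of R (R ⧸ I)) := inferInstanceAs (Module.Finite R (R ⧸ I))
  exact Module.Finite.equiv e.symm

lemma subsingleton_ext_of_subsingleton (X N : ModuleCat.{u} R) [Subsingleton N] (i : ℕ) :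
    Subsingleton (Abelian.Ext X N i) := by
  refine subsingleton_of_forall_eq 0 fun x ↦ ?_
  have h : 𝟙 N = 0 := by
    ext y
    exact Subsingleton.elim _ _
  rw [← Ext.comp_mk₀_id x, h, Ext.mk₀_zero, Ext.comp_zero]

lemma extLimit.subsingleton_of_subsingleton (N : ModuleCat.{u} R) [Subsingleton N] (i : ℕ) :
    Subsingleton (extLimit I i N) := by
  refine subsingleton_of_forall_eq 0 fun x ↦ ?_
  obtain ⟨t, y, rfl⟩ := extLimit.exists_of I x
  have := subsingleton_ext_of_subsingleton (powQuot I t) N i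
  rw [Subsingleton.elim y 0, map_zero]

end RelativeCohenMacaulay

/-! ### Failure of finite generation in positive degree. -/

section TopNotFinite

variable {K : Type u} [Field K] {σ : Type}

lemma pow_smul_top_eq_top {R : Type u} [CommRing R] {I : Ideal R} {N : Type u} [AddCommGroup N]
    [Module R N] (h : I • (⊤ : Submodule R N) = ⊤) (t : ℕ) : I ^ t • (⊤ : Submodule R N) = ⊤ := by
  induction t with
  | zero => rw [pow_zero, Ideal.one_eq_top, Submodule.top_smul]
  | succ t ih => rw [pow_succ, Submodule.mul_smul, h, ih]

/-- Local cohomology concentrated in one positive degree is not finitely generated. -/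
lemma IsConcentrated.not_finite [Finite σ] {s : Finset σ} {c : ℕ} {N : Type u} [AddCommGroup N]
    [Module (MvPolynomial σ K) N] (h : IsConcentrated (variableIdeal K s) c N) (hc : 0 < c) :
    ¬ Module.Finite (MvPolynomial σ K) (H (variableIdeal K s) c N) := by
  intro hfin
  -- In degree `s.card` the `Ext` module of `H` surjects onto `H/IH`; after the shift its degree
  -- `s.card + c` exceeds the number of variables, because `c > 0`.
  obtain ⟨e⟩ := h.nonempty_ext_equiv s.card
  have h0 := subsingleton_ext_variableQuot s (ModuleCat.of (MvPolynomial σ K) N) (s.card + c) (by omega)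
  have h1 : Subsingleton (Abelian.Ext (variableQuot K s) (H (variableIdeal K s) c N) s.card) :=
    e.toEquiv.subsingleton
  obtain ⟨φ, -, hker⟩ := exists_surjective_ext_variableQuot s (H (variableIdeal K s) c N)
  have htop : variableIdeal K s • (⊤ : Submodule _ (H (variableIdeal K s) c N)) = ⊤ :=
    top_le_iff.1 (le_trans (fun x _ ↦ Subsingleton.elim _ _) hker)
  -- Finite generation makes one exponent `t` work for all of `H`, against `I ^ t H = H`.
  obtain ⟨t, ht⟩ := exists_pow_smul_eq_zero_of_fg (variableIdeal K s) hfin.fg_top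
    fun x _ ↦ H_exists_pow_smul_eq_zero _ c N x
  have hbot : (⊤ : Submodule (MvPolynomial σ K) (H (variableIdeal K s) c N)) = ⊥ := by
    rw [← pow_smul_top_eq_top htop t, eq_bot_iff, Submodule.smul_le]
    exact fun a ha x hx ↦ ht a ha x hx
  have := h.1
  exact not_subsingleton _ ((Submodule.subsingleton_iff _).1
    (subsingleton_of_bot_eq_top hbot.symm))

lemma idealQ_eq_variableIdeal (K : Type u) [Field K] (m n : ℕ) :
    idealQ K m n = variableIdeal K (Finset.univ.map Function.Embedding.inr) := by
  rw [idealQ, variableIdeal]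
  congr 1
  ext p
  simp

end TopNotFinite

/-! ### Local cohomology along the filtration. -/

section Filtration

variable {R : Type u} [CommRing R] {I : Ideal R}

/-- Below the degree in which the cohomology of `X₃` is concentrated, `X₁` and `X₂` have the same
local cohomology. -/
lemma extLimit.nonempty_equiv_of_lt {S : ShortComplex (ModuleCat.{u} R)} (hS : S.ShortExact) {c : ℕ}
    (h : ∀ j, j ≠ c → Subsingleton (extLimit I j S.X₃)) {k : ℕ} (hk : k < c) :
    Nonempty (extLimit I k S.X₁ ≃ₗ[R] extLimit I k S.X₂) := by
  refine ⟨LinearEquiv.ofBijective (extLimit.postcomp I (Ext.mk₀ S.f) (add_zero k))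
    ⟨?_, fun x ↦ ?_⟩⟩
  · rcases k with - | k
    · have := hS.mono_f
      exact extLimit.postcomp_zero_injective I S.f
    · rw [← LinearMap.ker_eq_bot, LinearMap.ker_eq_bot']
      intro x hx
      obtain ⟨y, rfl⟩ := extLimit.exact₁ I hS rfl x hx
      have := h k (by omega)
      rw [Subsingleton.elim y 0, map_zero]
  · have := h k (by omega)
    exact extLimit.exact₂ I hS k x (Subsingleton.elim _ _)

/-- Meant for the new top degree `c` of a filtration step: `X₁` has nothing in degrees `c` and `c +
1`, so only the quotient contributes. -/
lemma extLimit.nonempty_equiv_of_subsingleton {S : ShortComplex (ModuleCat.{u} R)}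
    (hS : S.ShortExact) {c : ℕ} (h : ∀ j, c ≤ j → Subsingleton (extLimit I j S.X₁)) :
    Nonempty (extLimit I c S.X₂ ≃ₗ[R] extLimit I c S.X₃) := by
  refine ⟨LinearEquiv.ofBijective (extLimit.postcomp I (Ext.mk₀ S.g) (add_zero c))
    ⟨?_, fun x ↦ ?_⟩⟩
  · rw [← LinearMap.ker_eq_bot, LinearMap.ker_eq_bot']
    intro x hx
    obtain ⟨y, rfl⟩ := extLimit.exact₂ I hS c x hx
    have := h c le_rfl
    rw [Subsingleton.elim y 0, map_zero]
  · have := h (c + 1) (Nat.le_succ c)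
    exact extLimit.exact₃ I hS rfl x (Subsingleton.elim _ _)

lemma extLimit.subsingleton_middle {S : ShortComplex (ModuleCat.{u} R)}
    (hS : S.ShortExact) {k : ℕ} (h₁ : Subsingleton (extLimit I k S.X₁))
    (h₃ : Subsingleton (extLimit I k S.X₃)) : Subsingleton (extLimit I k S.X₂) := by
  refine subsingleton_of_forall_eq 0 fun x ↦ ?_
  obtain ⟨y, rfl⟩ := extLimit.exact₂ I hS k x (Subsingleton.elim _ _)
  rw [Subsingleton.elim y 0, map_zero]

variable {M : Type u} [AddCommGroup M] [Module R M] {r : ℕ}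

/-- The short exact sequence `0 → F_i → F_{i+1} → F_{i+1} / F_i → 0`. -/
lemma exists_shortExact_filtQuot {F : Fin (r + 1) → Submodule R M} (hF : Monotone F) (i : Fin r) :
    ∃ (f : ModuleCat.of R (F i.castSucc) ⟶ ModuleCat.of R (F i.succ))
      (g : ModuleCat.of R (F i.succ) ⟶ ModuleCat.of R (FiltQuot F i)) (w : f ≫ g = 0),
      (ShortComplex.mk f g w).ShortExact := by
  have hle : F i.castSucc ≤ F i.succ := hF i.castSucc_le_succ
  refine ⟨ModuleCat.ofHom (Submodule.inclusion hle), ModuleCat.ofHom (Submodule.mkQ _), ?_,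
    ModuleCat.shortComplex_shortExact _ (fun x ↦ ?_) (Submodule.inclusion_injective hle)
      (Submodule.mkQ_surjective _)⟩
  · ext x
    exact (Submodule.Quotient.mk_eq_zero _).2 x.2
  · refine (Submodule.Quotient.mk_eq_zero _).trans ⟨fun hx ↦ ⟨⟨x.1, hx⟩, rfl⟩, ?_⟩
    rintro ⟨y, rfl⟩
    exact y.2

/-- The local cohomology of the members of a filtration whose successive quotients have local
cohomology concentrated in strictly increasing degrees `c`. -/
lemma extLimit_filtration {F : Fin (r + 1) → Submodule R M} (hF : Monotone F) (h0 : F 0 = ⊥)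
    {c : Fin r → ℕ} (hc : StrictMono c) (h : ∀ i, IsConcentrated I (c i) (FiltQuot F i))
    (i : Fin (r + 1)) :
    (∀ k, (∀ j : Fin r, j.castSucc < i → c j ≠ k) →
      Subsingleton (extLimit I k (ModuleCat.of R (F i)))) ∧
    ∀ j : Fin r, j.castSucc < i → Nonempty (extLimit I (c j) (ModuleCat.of R (F i)) ≃ₗ[R]
      extLimit I (c j) (ModuleCat.of R (FiltQuot F j))) := by
  induction i using Fin.induction with
  | zero =>
    refine ⟨fun k _ ↦ ?_, fun j hj ↦ absurd hj (Fin.not_lt_zero _)⟩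
    have : Subsingleton (ModuleCat.of R (F 0)) := by
      rw [h0]
      exact inferInstanceAs (Subsingleton (⊥ : Submodule R M))
    exact extLimit.subsingleton_of_subsingleton _ k
  | succ i ih =>
    obtain ⟨ih1, ih2⟩ := ih
    obtain ⟨f, g, w, hS⟩ := exists_shortExact_filtQuot hF i
    have h3 (k : ℕ) (hk : k ≠ c i) :
        Subsingleton (extLimit I k (ModuleCat.of R (FiltQuot F i))) :=
      (subsingleton_H_iff I k _).1 ((h i).2 k hk)
    -- The earlier quotients contribute only in degrees below `c i`.
    have h1 (k : ℕ) (hk : c i ≤ k) :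
        Subsingleton (extLimit I k (ModuleCat.of R (F i.castSucc))) :=
      ih1 k fun j hj ↦ ((hc (Fin.castSucc_lt_castSucc_iff.1 hj)).trans_le hk).ne
    refine ⟨fun k hk ↦ ?_, fun j hj ↦ ?_⟩
    · exact extLimit.subsingleton_middle hS
        (ih1 k fun j hj ↦ hk j (hj.trans i.castSucc_lt_succ))
        (h3 k (hk i i.castSucc_lt_succ).symm)
    -- Degree `c i` comes from the new quotient, the lower degrees from the previous member.
    · rcases (Fin.castSucc_lt_succ_iff.1 hj).eq_or_lt with rfl | hlt
      · exact extLimit.nonempty_equiv_of_subsingleton hS h1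
      · obtain ⟨e⟩ := extLimit.nonempty_equiv_of_lt hS h3 (hc hlt)
        obtain ⟨e'⟩ := ih2 j (Fin.castSucc_lt_castSucc_iff.2 hlt)
        exact ⟨e.symm.trans e'⟩

/-- The cohomological dimension of the members of such a filtration. -/
lemma cd_filtration {F : Fin (r + 1) → Submodule R M} (hF : Monotone F) (h0 : F 0 = ⊥)
    {c : Fin r → ℕ} (hc : StrictMono c) (h : ∀ i, IsConcentrated I (c i) (FiltQuot F i))
    (i : Fin r) : cd I (F i.succ) = ((c i : ℕ∞) : WithBot ℕ∞) := by
  obtain ⟨h1, h2⟩ := extLimit_filtration hF h0 hc h i.succ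
  refine IsLUB.sSup_eq (IsGreatest.isLUB ⟨⟨c i, ?_, rfl⟩, ?_⟩)
  · obtain ⟨e⟩ := h2 i i.castSucc_lt_succ
    obtain ⟨e₁⟩ := nonempty_H_equiv_extLimit I (c i) (F i.succ)
    obtain ⟨e₂⟩ := nonempty_H_equiv_extLimit I (c i) (FiltQuot F i)
    have := (h i).1
    exact (e₁.trans (e.trans e₂.symm)).toEquiv.nontrivial
  · rintro _ ⟨k, hk, rfl⟩
    by_contra hlt
    have hlt : c i < k := by simpa using hlt
    refine not_subsingleton _ ((subsingleton_H_iff I k (F i.succ)).2 (h1 k fun j hj ↦ ?_))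
    exact ((hc.monotone (Fin.castSucc_lt_succ_iff.1 hj)).trans_lt hlt).ne

/-- The local cohomology of a module with such a filtration. -/
lemma H_filtration {F : Fin (r + 1) → Submodule R M} (hF : Monotone F) (h0 : F 0 = ⊥)
    (htop : F (Fin.last r) = ⊤)
    {c : Fin r → ℕ} (hc : StrictMono c) (h : ∀ i, IsConcentrated I (c i) (FiltQuot F i)) :
    (∀ k, (∀ j, c j ≠ k) → Subsingleton (H I k M)) ∧
    ∀ j, Nonempty (H I (c j) M ≃ₗ[R] H I (c j) (FiltQuot F j)) := by
  obtain ⟨h1, h2⟩ := extLimit_filtration hF h0 hc h (Fin.last r)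
  have e : ModuleCat.of R (F (Fin.last r)) ≃ₗ[R] ModuleCat.of R M := LinearEquiv.ofTop _ htop
  refine ⟨fun k hk ↦ ?_, fun j ↦ ?_⟩
  · have := h1 k fun j _ ↦ hk j
    obtain ⟨e'⟩ := extLimit.nonempty_congr I e k
    exact (subsingleton_H_iff I k M).2 e'.symm.toEquiv.subsingleton
  · obtain ⟨e₁⟩ := nonempty_H_equiv_extLimit I (c j) M
    obtain ⟨e₂⟩ := extLimit.nonempty_congr I e (c j)
    obtain ⟨e₃⟩ := h2 j (Fin.castSucc_lt_last j)
    obtain ⟨e₄⟩ := nonempty_H_equiv_extLimit I (c j) (FiltQuot F j)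
    exact ⟨e₁.trans (e₂.symm.trans (e₃.trans e₄.symm))⟩

/-- `H^k(M)` is either zero or the cohomology of one concentrated, finitely generated quotient. -/
lemma isCofinite_H_of_filtration [IsNoetherianRing R] [Module.Finite R M]
    {F : Fin (r + 1) → Submodule R M} (hF : Monotone F) (h0 : F 0 = ⊥)
    (htop : F (Fin.last r) = ⊤) {c : Fin r → ℕ} (hc : StrictMono c)
    (h : ∀ i, IsConcentrated I (c i) (FiltQuot F i)) (k : ℕ) : IsCofinite I (H I k M) := by
  refine ⟨support_H_subset I k M, fun i ↦ ?_⟩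
  obtain ⟨h1, h2⟩ := H_filtration hF h0 htop hc h
  by_cases hk : ∃ j, c j = k
  · obtain ⟨j, rfl⟩ := hk
    obtain ⟨e⟩ := h2 j
    have := (h j).finite_ext i
    exact Module.Finite.equiv (extCongr _ e i).symm
  · push Not at hk
    have := h1 k hk
    have := subsingleton_ext_of_subsingleton (ModuleCat.of R (R ⧸ I)) (H I k M) i
    infer_instance

end Filtration

lemma IsCMFiltration.exists_isConcentrated {K : Type u} [Field K] {m n : ℕ}
    {M : Type u} [AddCommGroup M] [Module (PolyRing K m n) M]
    {ℳ : ℤ × ℤ → AddSubgroup M} [DirectSum.Decomposition ℳ] {r : ℕ}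
    {F : Fin (r + 1) → Submodule (PolyRing K m n) M} (hF : IsCMFiltration ℳ F) :
    ∃ c : Fin r → ℕ, StrictMono c ∧
      ∀ i, IsConcentrated (idealQ K m n) (c i) (FiltQuot F i) := by
  choose c hc using fun i ↦ BigradedCM.exists_isConcentrated (hF.cohenMacaulay i) (hF.cd_nonneg i)
  refine ⟨c, fun i j hij ↦ ?_, hc⟩
  have := hF.cd_strictMono hij
  simp only [(hc i).cd_eq, (hc j).cd_eq] at this
  exact_mod_cast this

end BigradedCM

theorem mainTheorem9 {K : Type u} [Field K] (m n : ℕ)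
    {M : Type u} [AddCommGroup M] [Module (BigradedCM.PolyRing K m n) M]
    [Module.Finite (BigradedCM.PolyRing K m n) M]
    (ℳ : ℤ × ℤ → AddSubgroup M) [DirectSum.Decomposition ℳ]
    [SetLike.GradedSMul (BigradedCM.bigrading K m n) ℳ]
    (hM : BigradedCM.IsSequentiallyCM K m n ℳ) :
    (∀ (r : ℕ) (F : Fin (r + 1) → Submodule (BigradedCM.PolyRing K m n) M),
      BigradedCM.IsCMFiltration ℳ F →
      (∀ hr : 0 < r, 0 < BigradedCM.cd (BigradedCM.idealQ K m n) (F (Fin.succ ⟨0, hr⟩))) →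
      ∀ k : ℕ,
        (∃ i : Fin r, BigradedCM.cd (BigradedCM.idealQ K m n) (F i.succ) = ((k : ℕ∞) : WithBot ℕ∞)) →
        ¬ Module.Finite (BigradedCM.PolyRing K m n) (BigradedCM.H (BigradedCM.idealQ K m n) k M)) ∧
    ∀ k : ℕ, BigradedCM.IsCofinite (BigradedCM.idealQ K m n)
      (BigradedCM.H (BigradedCM.idealQ K m n) k M) := by
  refine ⟨fun r F hF hpos k ⟨i, hi⟩ hfin ↦ ?_, fun k ↦ ?_⟩
  · obtain ⟨c, hc, h⟩ := hF.exists_isConcentrated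
    have hr : 0 < r := i.pos
    have h0 := hpos hr
    rw [BigradedCM.cd_filtration hF.strictMono.monotone hF.bot hc h] at h0 hi
    have h0 : 0 < c ⟨0, hr⟩ := by exact_mod_cast h0
    obtain rfl : c i = k := by exact_mod_cast hi
    -- The degrees increase, so positivity of the first one, `q_1`, passes to all.
    have hci : 0 < c i := h0.trans_le (hc.monotone (Fin.mk_le_of_le_val (Nat.zero_le _)))
    obtain ⟨e⟩ := (BigradedCM.H_filtration hF.strictMono.monotone hF.bot hF.top hc h).2 i
    have hfin' := Module.Finite.equiv e
    have hcon := h i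
    rw [BigradedCM.idealQ_eq_variableIdeal] at hcon hfin'
    exact hcon.not_finite hci hfin'
  · obtain ⟨r, F, hF⟩ := hM
    obtain ⟨c, hc, h⟩ := hF.exists_isConcentrated
    exact BigradedCM.isCofinite_H_of_filtration hF.strictMono.monotone hF.bot hF.top hc h k
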